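/- For $k,x\in\{0,1\}^c$ let $\mathsf{Par}_k(x)=\bigoplus_{j} k_jx_j$; for $t,y\in\{0,1\}^b$, read as integers in $\{0,\dots,2^b-1\}$, let $\mathsf{Thr}_t(y)=1$ if $y\ge t$ and $0$ otherwise. Let $\mathsf{ParityThresh}_{b,c}$ be the class of all functions $(x,y)\mapsto \mathsf{Par}_k(x)\oplus\mathsf{Thr}_t(y)$ on $\{0,1\}^c\times\{0,1\}^b$ with $k\in\{0,1\}^c$, $t\in\{0,1\}^b$. We consider protocols between a referee without input and parties that each hold some labeled examples, have private random coins and communicate only with the referee, by messages that are finite strings. In each round the referee sends a message to every party and every party replies; after the last round the referee outputs a hypothesis. In the $(m,n)$-hybrid model the parties are a curator holding $m$ examples and $n$ local agents holding one example each; in the local model with $N$ agents there are $N$ parties holding one example each; in the curator model with $M$ samples there is a single party, holding $M$ examples. A protocol is non-interactive if there is one round, in which the referee sends nothing and all parties simultaneously send one message. It is $\varepsilon$-differentially private if for every party $P$, every randomized adversary $A$ that interacts with $P$ in place of everybody else (sending arbitrary messages), all inputs $\mathbf x,\mathbf x'$ of $P$ that differ in at most one example, and every measurable event $T$, the output of $A$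 satisfies $\Pr[A_P(\mathbf x)\in T]\le e^{\varepsilon}\Pr[A_P(\mathbf x')\in T]$. It is an $(\alpha,\beta)$-PAC learner for a class $\mathcal C$ of functions $X\to\{0,1\}$ if for every $f\in\mathcal C$ and every probability distribution $\mathcal D$ on $X$, when all examples are drawn i.i.d. from $\mathcal D$ and labeled by $f$, the output $h$ satisfies $\Pr_{x\sim\mathcal D}[h(x)\ne f(x)]\le\alpha$ with probability at least $1-\beta$. For $c\ge 1$ call a protocol a private learner if it is $\frac14$-differentially private and a $(\frac14,\frac14)$-PAC learner for $\mathsf{ParityThresh}_{b,c}$ with $b=c^2$. **Theorem.** There are functions $m=m(c)=\Theta(c)$ and $n=n(c)=\Theta(c^6\log c)$ such that, as $c\to\infty$ where asymptotic notation is used: 1. For every $c\ge1$ there is a non-interactive private learner in the $(m,n)$-hybrid model. 2. Every private learner in the local model with $o\bigl(2^{(n/\log n)^{1/6}}\bigr)$ agents uses $2^{\Omega((n/\log n)^{1/6})}$ rounds. That is, there is $\kappa>0$ such that for all $N=N(c)=o\bigl(2^{(n/\log n)^{1/6}}\bigr)$ and all sufficiently large $c$, every private learner in the local model with $N$ agents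 has at least $2^{\kappa (n/\log n)^{1/6}}$ rounds. 3. Every private learner in the curator model needs $\Omega(m^2)$ samples. That is, there is $\kappa>0$ such that for all sufficiently large $c$, every private learner in the curator model uses at least $\kappa m^2$ samples. -/

import Mathlib

open MeasureTheory Filter Asymptotics

/-! ## Interactive protocols between a referee and input-holding parties -/

/-- Messages are finite strings, coded as natural numbers; `0` codes the empty string. -/
abbrev Msg : Type := ℕ

/-- An interactive randomized functionality that holds `ℓ` data points from `Z`. Its next message
is a function of its input, its private random coins and the messages it has received so far
(most recent one first). The coins come from an arbitrary probability space. -/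
structure Party (ℓ : ℕ) (Z : Type) : Type 1 where
  Coins : Type
  [space : MeasurableSpace Coins]
  law : Measure Coins
  [isProb : IsProbabilityMeasure law]
  next : (Fin ℓ → Z) → Coins → List Msg → Msg
  measurable_next : ∀ x received, Measurable fun ω => next x ω received

attribute [instance] Party.space Party.isProb

/-- A protocol between parties indexed by `ι`, where party `i` holds `ℓ i` data points, and a
referee without input. The parties communicate only with the referee. In each round the referee
sends a message to every party (a function of its coins and of all replies of the earlier rounds,
most recent round first), and then every party replies. After the last round the referee writes
an output in `O`. A string of shared randomness can be part of the first messages of the referee. -/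
structure Protocol (ι : Type) (ℓ : ι → ℕ) (Z O : Type) [MeasurableSpace O] : Type 1 where
  rounds : ℕ
  party : (i : ι) → Party (ℓ i) Z
  RefCoins : Type
  [refSpace : MeasurableSpace RefCoins]
  refLaw : Measure RefCoins
  [refIsProb : IsProbabilityMeasure refLaw]
  query : RefCoins → List (ι → Msg) → ι → Msg
  measurable_query : ∀ replies i, Measurable fun ρ => query ρ replies i
  output : RefCoins → List (ι → Msg) → O
  measurable_output : ∀ replies, Measurable fun ρ => output ρ replies

attribute [instance] Protocol.refSpace Protocol.refIsProb

namespace Protocol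

variable {ι : Type} {ℓ : ι → ℕ} {Z O : Type} [MeasurableSpace O]

/-- The state of an execution after a number of rounds: for every party the messages it has
received, and the replies that the referee has received (most recent ones first). -/
def run (P : Protocol ι ℓ Z O) (x : (i : ι) → Fin (ℓ i) → Z)
    (ω : (i : ι) → (P.party i).Coins) (ρ : P.RefCoins) :
    ℕ → (ι → List Msg) × List (ι → Msg)
  | 0 => (fun _ => [], [])
  | t + 1 =>
    let s := P.run x ω ρ t
    let received : ι → List Msg := fun i => P.query ρ s.2 i :: s.1 i
    (received, (fun i => (P.party i).next (x i) (ω i) (received i)) :: s.2)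

/-- The output of the referee on the given joint input and coins. -/
def outcome (P : Protocol ι ℓ Z O) (x : (i : ι) → Fin (ℓ i) → Z)
    (ω : (i : ι) → (P.party i).Coins) (ρ : P.RefCoins) : O :=
  P.output ρ (P.run x ω ρ P.rounds).2

/-- All parties simultaneously send a single message to the referee, who sends nothing. -/
def NonInteractive (P : Protocol ι ℓ Z O) : Prop :=
  P.rounds = 1 ∧ ∀ ρ i, P.query ρ [] i = 0

end Protocol

/-! ## Differential privacy against malicious adversaries -/

/-- An adversary, that is, an interactive randomized functionality that controls everybody except
one party. It sees the replies of that party (most recent one first), sends it arbitrary messages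
and finally produces an output. -/
structure Adversary : Type 1 where
  Coins : Type
  [space : MeasurableSpace Coins]
  law : Measure Coins
  [isProb : IsProbabilityMeasure law]
  query : Coins → List Msg → Msg
  measurable_query : ∀ replies, Measurable fun a => query a replies
  Out : Type
  [outSpace : MeasurableSpace Out]
  output : Coins → List Msg → Out
  measurable_output : ∀ replies, Measurable fun a => output a replies

attribute [instance] Adversary.space Adversary.isProb Adversary.outSpace

/-- The state of the interaction of the party `p` with the adversary `A` after a number of rounds:
the messages received by `p` and the replies of `p` (most recent ones first). -/
def Party.interact {ℓ : ℕ} {Z : Type} (p : Party ℓ Z) (A : Adversary) (x : Fin ℓ → Z)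
    (ω : p.Coins) (a : A.Coins) : ℕ → List Msg × List Msg
  | 0 => ([], [])
  | t + 1 =>
    let s := p.interact A x ω a t
    let received := A.query a s.2 :: s.1
    (received, p.next x ω received :: s.2)

/-- The probability that the output of the adversary `A` lies in `T` after it has interacted for
`r` rounds with the party `p` on input `x`. -/
noncomputable def Party.advProb {ℓ : ℕ} {Z : Type} (p : Party ℓ Z) (r : ℕ) (A : Adversary)
    (x : Fin ℓ → Z) (T : Set A.Out) : ℝ :=
  (p.law.prod A.law).real {s | A.output s.2 (p.interact A x s.1 s.2 r).2 ∈ T}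

/-- Two databases are neighboring if they differ on at most one entry. -/
def Neighboring {ℓ : ℕ} {Z : Type} (x x' : Fin ℓ → Z) : Prop :=
  ∃ i, ∀ j, j ≠ i → x j = x' j

/-- `(ε, δ)`-differential privacy of a protocol. The relation `Neighboring` is symmetric, so both
inequalities in the definition of `(ε, δ)`-closeness are covered. -/
def Protocol.IsApproxDP {ι : Type} {ℓ : ι → ℕ} {Z O : Type} [MeasurableSpace O]
    (P : Protocol ι ℓ Z O) (ε δ : ℝ) : Prop :=
  ∀ (i : ι) (A : Adversary) (x x' : Fin (ℓ i) → Z), Neighboring x x' →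
    ∀ T : Set A.Out, MeasurableSet T →
      (P.party i).advProb P.rounds A x T
        ≤ Real.exp ε * (P.party i).advProb P.rounds A x' T + δ

/-- Pure `ε`-differential privacy. -/
def Protocol.IsDP {ι : Type} {ℓ : ι → ℕ} {Z O : Type} [MeasurableSpace O]
    (P : Protocol ι ℓ Z O) (ε : ℝ) : Prop :=
  P.IsApproxDP ε 0

/-! ## PAC learning -/

/-- The generalization error of the hypothesis `h` with respect to the concept `f` and the
distribution `D`. -/
noncomputable def genError {X : Type} [MeasurableSpace X] (D : Measure X) (f h : X → Bool) : ℝ :=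
  D.real {x | h x ≠ f x}

/-- The protocol `P` is an `(α, β)`-PAC learner for the concept class `C`: for every `f ∈ C` and
every distribution `D`, when all the data points are drawn independently from `D` and labeled by
`f`, the output has error at most `α` with probability at least `1 - β`. -/
def Protocol.IsPACLearner {ι : Type} [Fintype ι] {ℓ : ι → ℕ} {X : Type} [MeasurableSpace X]
    (P : Protocol ι ℓ (X × Bool) (X → Bool)) (C : Set (X → Bool)) (α β : ℝ) : Prop :=
  ∀ f ∈ C, ∀ D : Measure X, IsProbabilityMeasure D →
    1 - β ≤
      ((Measure.pi fun i : ι => Measure.pi fun _ : Fin (ℓ i) => D).prod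
        ((Measure.pi fun i : ι => (P.party i).law).prod P.refLaw)).real
        {s | genError D f
          (P.outcome (fun i j => (s.1 i j, f (s.1 i j))) s.2.1 s.2.2) ≤ α}

/-! ## The curator model, the local model and the hybrid model -/

/-- Protocols in the curator model with `m` samples: a single party that holds all the data. -/
abbrev CuratorProtocol (m : ℕ) (Z O : Type) [MeasurableSpace O] : Type 1 :=
  Protocol Unit (fun _ => m) Z O

/-- Protocols in the local model with `n` agents, each of which holds a single data point. -/
abbrev LocalProtocol (n : ℕ) (Z O : Type) [MeasurableSpace O] : Type 1 :=
  Protocol (Fin n) (fun _ => 1) Z O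

/-- The number of data points of each party in the `(m, n)`-hybrid model; `none` is the curator. -/
def hybridSize (m n : ℕ) : Option (Fin n) → ℕ
  | none => m
  | some _ => 1

/-- Protocols in the `(m, n)`-hybrid model: a curator with `m` data points and `n` local agents
with one data point each. -/
abbrev HybridProtocol (m n : ℕ) (Z O : Type) [MeasurableSpace O] : Type 1 :=
  Protocol (Option (Fin n)) (hybridSize m n) Z O

/-! ## Parity XOR threshold -/

/-- The strings `{0,1}^c`. -/
abbrev Bits (c : ℕ) : Type := Fin c → Bool

/-- `Par_k(x) = ⊕ j, k_j x_j`. -/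
def par {c : ℕ} (k x : Bits c) : Bool :=
  decide (Odd (Finset.univ.filter fun j => k j = true ∧ x j = true).card)

/-- The integer in `{0, …, 2^b - 1}` that a string represents in binary (most significant bit
first). -/
def Bits.val {b : ℕ} (y : Bits b) : ℕ :=
  ∑ i : Fin b, if y i = true then 2 ^ (Fin.rev i : ℕ) else 0

/-- `Thr_t(y) = 1` if and only if `y ≥ t`. -/
def thr {b : ℕ} (t y : Bits b) : Bool :=
  decide (t.val ≤ y.val)

/-- The concept class of all functions `(x, y) ↦ Par_k(x) ⊕ Thr_t(y)`. -/
def ParityThresh (b c : ℕ) : Set (Bits c × Bits b → Bool) :=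
  {f | ∃ (k : Bits c) (t : Bits b), f = fun z => xor (par k z.1) (thr t z.2)}

/-- A `1/4`-differentially private `(1/4, 1/4)`-PAC learner for `ParityThresh b c`. -/
def Protocol.IsPrivateLearner {ι : Type} [Fintype ι] {ℓ : ι → ℕ} {b c : ℕ}
    (P : Protocol ι ℓ ((Bits c × Bits b) × Bool) (Bits c × Bits b → Bool)) : Prop :=
  P.IsDP (1 / 4) ∧ P.IsPACLearner (ParityThresh b c) (1 / 4) (1 / 4)

/-- The exponent `(n / log n)^(1/6)`, with the logarithm to base `2`. -/
noncomputable def localExponent (n : ℕ) : ℝ :=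
  ((n : ℝ) / Real.logb 2 n) ^ (1 / 6 : ℝ)

/-! ## Binary strings, thresholds and parities -/

/-! Three facts about `ParityThresh` with `b = c ^ 2` are combined.

Upper bound (`hybridLearner_isPACLearner`). Parities are cheap for a curator and expensive for local
agents, while thresholds on `b` bits are cheap for local agents and cost a purely private curator
order `b` samples. So the work is split. The curator runs the exponential mechanism but releases
only a parity and the quantile of a threshold, rounded to a multiple of `1 / 128`. With `129 * 2 ^
c` possible outputs, O(c) samples suffice. The agents provide unbiased estimators of the mass below
every threshold simultaneously: `y` is below `t` if and only if it leaves the binary path of `t` at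
a level where `t` has a one, and each agent tests one random level by randomized response. The
estimators have size `10 * b`, so a union bound over `2 ^ b` thresholds asks for O(b ^ 3) = O(c ^ 6)
agents. The referee turns the quantile back into a threshold. Neither side needs the message of the
other, so one round is enough.

Curator lower bound (`curator_lower_bound`), by packing. Each threshold gets the uniform
distribution on the branch points of its binary search. For a fixed hypothesis, the error pattern on
these points determines the threshold, so a hypothesis is good for an exponentially small fraction
of thresholds only. Group privacy changes probabilities by at most `exp (M / 4)`, hence `M` is at
least of order `b`.

Local lower bound (`local_lower_bound`). For fixed coins of the referee, the probability of a
transcript is a product over the agents, and privacy lets each factor vary by at most a factor `2`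
with the input. Replacing random labels by a parity shifts a factor by a Fourier coefficient, which
by Parseval is of relative size `2 ^ (-c / 2)` on average over the parities. A hypothesis is close
to at most four parities, so order `2 ^ (c / 2)` agents are necessary, whatever the number of
rounds. The claim on rounds follows vacuously: the constant in `agentCount` is so small that
eventually `2 ^ localExponent n ≤ 2 ^ (c / 4)`, and with so few agents there is no learner at all.
-/

lemma Bits.val_succ {b : ℕ} (y : Bits (b + 1)) :
    Bits.val y = (if y 0 = true then 2 ^ b else 0) + Bits.val (b := b) (fun i => y i.succ) := by
  simp [Bits.val, Fin.sum_univ_succ]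

lemma Bits.val_lt_two_pow {b : ℕ} (y : Bits b) : Bits.val y < 2 ^ b := by
  induction b with
  | zero => simp [Bits.val]
  | succ b ih =>
    rw [Bits.val_succ, pow_succ]
    have := ih fun i => y i.succ
    split_ifs <;> omega

/-- The order of the represented integers is the lexicographic order of the strings. -/
lemma Bits.val_lt_val_iff {b : ℕ} (y t : Bits b) :
    Bits.val y < Bits.val t ↔ ∃ j, t j = true ∧ y j = false ∧ ∀ i < j, y i = t i := by
  induction b with
  | zero => simp [Bits.val]
  | succ b ih =>
    rw [Bits.val_succ, Bits.val_succ, Fin.exists_fin_succ]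
    have h := ih (fun i => y i.succ) fun i => t i.succ
    have h1 := Bits.val_lt_two_pow fun i => y i.succ
    have h2 := Bits.val_lt_two_pow fun i => t i.succ
    have key : (∃ i : Fin b, t i.succ = true ∧ y i.succ = false ∧ ∀ i' < i.succ, y i' = t i') ↔
        y 0 = t 0 ∧ Bits.val (fun i => y i.succ) < Bits.val fun i => t i.succ := by
      rw [h]
      constructor
      · rintro ⟨i, h1, h2, h3⟩
        exact ⟨h3 0 (Fin.succ_pos i), i, h1, h2, fun i' hi' => h3 _ (Fin.succ_lt_succ_iff.2 hi')⟩
      · rintro ⟨h0, i, h1, h2, h3⟩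
        refine ⟨i, h1, h2, fun i' => Fin.cases (fun _ => h0) (fun j hj => ?_) i'⟩
        exact h3 j (Fin.succ_lt_succ_iff.1 hj)
    rw [key]
    cases hy : y 0 <;> cases ht : t 0 <;> simp <;> omega

/-- The sign `±1` of a bit. -/
def sgn (a : Bool) : ℝ := if a = true then -1 else 1

lemma sgn_mul_self (a : Bool) : sgn a * sgn a = 1 := by cases a <;> simp [sgn]

lemma abs_sgn (a : Bool) : |sgn a| = 1 := by cases a <;> simp [sgn]

lemma sgn_par {c : ℕ} (k x : Bits c) :
    sgn (par k x) = ∏ j, if k j = true ∧ x j = true then (-1 : ℝ) else 1 := by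
  rw [Finset.prod_ite]
  rw [Finset.prod_const_one, mul_one, Finset.prod_const]
  by_cases h : Odd (Finset.univ.filter fun j => k j = true ∧ x j = true).card
  · simp [sgn, par, h, h.neg_one_pow]
  · simp [sgn, par, h, (Nat.not_odd_iff_even.1 h).neg_one_pow]

lemma Bits.sum_prod {c : ℕ} (f : Fin c → Bool → ℝ) :
    ∑ k : Bits c, ∏ j, f j (k j) = ∏ j, ∑ a, f j a := by
  rw [Finset.prod_univ_sum, Fintype.piFinset_univ]

/-- Characters are orthogonal. -/
lemma sum_sgn_par_mul {c : ℕ} (x x' : Bits c) :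
    ∑ k : Bits c, sgn (par k x) * sgn (par k x') = if x = x' then (2 : ℝ) ^ c else 0 := by
  let f (j : Fin c) (a : Bool) : ℝ := (if a = true ∧ x j = true then (-1 : ℝ) else 1) *
    (if a = true ∧ x' j = true then (-1 : ℝ) else 1)
  have h : ∀ k : Bits c, sgn (par k x) * sgn (par k x') =
      ∏ j, f j (k j) := by
    intro k
    rw [sgn_par, sgn_par, ← Finset.prod_mul_distrib]
  rw [Finset.sum_congr rfl fun k _ => h k, Bits.sum_prod]
  have h2 : ∀ j : Fin c, ∑ a, f j a = if x j = x' j then 2 else 0 := by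
    intro j
    simp only [f]
    cases x j <;> cases x' j <;> norm_num
  simp_rw [h2]
  split_ifs with hx
  · subst hx; simp
  · obtain ⟨j, hj⟩ := Function.ne_iff.1 hx
    exact Finset.prod_eq_zero (Finset.mem_univ j) (if_neg hj)

/-- Parseval's identity. -/
lemma sum_sq_fourier {c : ℕ} (v : Bits c → ℝ) :
    ∑ k : Bits c, (∑ x, v x * sgn (par k x)) ^ 2 = 2 ^ c * ∑ x, v x ^ 2 := by
  have h : ∀ k : Bits c, (∑ x, v x * sgn (par k x)) ^ 2 =
      ∑ x, ∑ x', v x * v x' * (sgn (par k x) * sgn (par k x')) := by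
    intro k
    rw [sq, Finset.sum_mul_sum]
    exact Finset.sum_congr rfl fun x _ => Finset.sum_congr rfl fun x' _ => by ring
  simp_rw [h]
  rw [Finset.sum_comm]
  simp_rw [Finset.sum_comm (s := (Finset.univ : Finset (Bits c))) (t := Finset.univ)
    (f := fun k x' => _ * v x' * (sgn (par k _) * sgn (par k x')))]
  simp_rw [← Finset.mul_sum, sum_sgn_par_mul]
  rw [Finset.mul_sum]
  refine Finset.sum_congr rfl fun x _ => ?_
  simp only [mul_ite, mul_zero, Finset.sum_ite_eq, Finset.mem_univ, if_true]
  ring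

/-! ## Counting events -/

/-- Linearity of expectation. In both lower bounds the events say that one random output is good for
the `k`-th concept, and `C` bounds how many concepts a single hypothesis serves. -/
lemma sum_measureReal_le_of_card_le {Ω κ : Type*} [MeasurableSpace Ω] [Fintype κ]
    (μ : Measure Ω) [IsProbabilityMeasure μ] (E : κ → Set Ω) (hE : ∀ k, MeasurableSet (E k))
    (C : ℝ) (hC : ∀ ω, ∑ k, (E k).indicator (fun _ => (1 : ℝ)) ω ≤ C) :
    ∑ k, μ.real (E k) ≤ C := by
  have hint : ∀ k, Integrable ((E k).indicator fun _ => (1 : ℝ)) μ := fun k =>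
    (integrable_const 1).indicator (hE k)
  calc ∑ k, μ.real (E k) = ∑ k, ∫ ω, (E k).indicator (fun _ => (1 : ℝ)) ω ∂μ := by
        refine Finset.sum_congr rfl fun k _ => ?_
        rw [integral_indicator_const _ (hE k)]; simp
    _ = ∫ ω, ∑ k, (E k).indicator (fun _ => (1 : ℝ)) ω ∂μ :=
        (integral_finsetSum _ fun k _ => hint k).symm
    _ ≤ ∫ _, C ∂μ := integral_mono (integrable_finsetSum _ fun k _ => hint k)
        (integrable_const _) hC
    _ = C := by simp

/-! ## Measurability of executions -/

/-- Coins are arbitrary, but inputs, messages and transcripts are countable, so measurability can be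
checked for each fixed value of `h`. -/
lemma Measurable.eval_countable {α β γ : Type*} [MeasurableSpace α] [MeasurableSpace β]
    [MeasurableSpace γ] [Countable β] [MeasurableSingletonClass β] {g : α → β → γ} {h : α → β}
    (hg : ∀ b, Measurable fun a => g a b) (hh : Measurable h) : Measurable fun a => g a (h a) := by
  have : Measurable fun p : α × β => g p.1 p.2 := measurable_from_prod_countable_left hg
  exact this.comp (measurable_id.prodMk hh)

instance instMeasurableSpaceListTop {α : Type*} : MeasurableSpace (List α) := ⊤

instance instDiscreteMeasurableSpaceList {α : Type*} : DiscreteMeasurableSpace (List α) :=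
  ⟨fun _ => trivial⟩

namespace Protocol

variable {ι : Type} {ℓ : ι → ℕ} {Z O : Type} [MeasurableSpace O]

/-- The data, the coins of the parties and the coins of the referee. -/
abbrev Sample (P : Protocol ι ℓ Z O) : Type :=
  ((i : ι) → Fin (ℓ i) → Z) × ((i : ι) → (P.party i).Coins) × P.RefCoins

lemma measurable_run [Fintype ι] [MeasurableSpace Z] [MeasurableSingletonClass Z] [Countable Z]
    (P : Protocol ι ℓ Z O) (t : ℕ) :
    Measurable fun s : P.Sample =>
      P.run s.1 s.2.1 s.2.2 t := by
  induction t with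
  | zero => exact measurable_const
  | succ t ih =>
    have h1 : ∀ i, Measurable fun s : P.Sample =>
        P.query s.2.2 (P.run s.1 s.2.1 s.2.2 t).2 i :: (P.run s.1 s.2.1 s.2.2 t).1 i := by
      intro i
      have hq : Measurable fun s : P.Sample =>
          P.query s.2.2 (P.run s.1 s.2.1 s.2.2 t).2 i :=
        Measurable.eval_countable (g := fun (s : P.Sample) r => P.query s.2.2 r i)
          (fun r => (P.measurable_query r i).comp (measurable_snd.comp measurable_snd)) ih.snd
      exact Measurable.eval_countable (β := List Msg)
        (g := fun (s : P.Sample) l => P.query s.2.2 (P.run s.1 s.2.1 s.2.2 t).2 i :: l)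
        (fun l => (Measurable.of_discrete (f := fun q : ℕ => q :: l)).comp hq)
        ((measurable_pi_apply i).comp ih.fst)
    have h2 : Measurable fun s : P.Sample =>
        fun i => (P.party i).next (s.1 i) (s.2.1 i)
          (P.query s.2.2 (P.run s.1 s.2.1 s.2.2 t).2 i :: (P.run s.1 s.2.1 s.2.2 t).1 i) := by
      refine measurable_pi_lambda _ fun i => ?_
      refine Measurable.eval_countable (β := (Fin (ℓ i) → Z) × List Msg)
        (g := fun (s : P.Sample) p => (P.party i).next p.1 (s.2.1 i) p.2)
        (fun p => ((P.party i).measurable_next p.1 p.2).comp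
          ((measurable_pi_apply i).comp (measurable_fst.comp measurable_snd)))
        (((measurable_pi_apply i).comp measurable_fst).prodMk (h1 i))
    refine (measurable_pi_lambda _ h1).prodMk ?_
    exact Measurable.eval_countable (β := List (ι → Msg))
      (g := fun (s : P.Sample) l => (fun i => (P.party i).next (s.1 i) (s.2.1 i)
          (P.query s.2.2 (P.run s.1 s.2.1 s.2.2 t).2 i :: (P.run s.1 s.2.1 s.2.2 t).1 i)) :: l)
      (fun l => (Measurable.of_discrete (f := fun q : ι → ℕ => q :: l)).comp h2) ih.snd

lemma measurable_outcome [Fintype ι] [MeasurableSpace Z] [MeasurableSingletonClass Z] [Countable Z]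
    (P : Protocol ι ℓ Z O) :
    Measurable fun s : P.Sample =>
      P.outcome s.1 s.2.1 s.2.2 :=
  Measurable.eval_countable (g := fun (s : P.Sample) l => P.output s.2.2 l)
    (fun l => (P.measurable_output l).comp (measurable_snd.comp measurable_snd))
    (P.measurable_run P.rounds).snd

end Protocol

/-! ## A lower bound for the curator model -/

/-- Group privacy: the entries of `x` are exchanged for those of `x'` one at a time, at a factor
`exp ε` each. -/
lemma le_exp_mul_of_neighboring {M : ℕ} {Z : Type} (g : (Fin M → Z) → ℝ) (ε : ℝ)
    (h : ∀ x x', Neighboring x x' → g x ≤ Real.exp ε * g x') (x x' : Fin M → Z) :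
    g x ≤ Real.exp (ε * M) * g x' := by
  have key : ∀ s : ℕ, s ≤ M →
      g x ≤ Real.exp (ε * s) * g fun j => if (j : ℕ) < s then x' j else x j := by
    intro s
    induction s with
    | zero => simp
    | succ s ih =>
      intro hs
      refine (ih (by omega)).trans ?_
      have h1 := h (fun j => if (j : ℕ) < s then x' j else x j)
        (fun j => if (j : ℕ) < s + 1 then x' j else x j)
        ⟨⟨s, hs⟩, fun j hj => by
          have : (j : ℕ) ≠ s := fun h => hj (Fin.ext h)
          by_cases hjs : (j : ℕ) < s
          · simp [hjs, Nat.lt_succ_of_lt hjs]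
          · simp [hjs, show ¬ (j : ℕ) < s + 1 by omega]⟩
      calc _ ≤ Real.exp (ε * s) * (Real.exp ε *
            g fun j => if (j : ℕ) < s + 1 then x' j else x j) := by gcongr
        _ = _ := by rw [← mul_assoc, ← Real.exp_add]; push_cast; ring_nf
  have := key M le_rfl
  simpa using this

/-- The point at which the search for the threshold `t` branches at level `j`. -/
def branchPoint {b : ℕ} (t : Bits b) (j : Fin b) : Bits b := fun i =>
  if i < j then t i else decide (j < i)

/-- The branch point is the largest string that follows `t` up to level `j` and has a zero there, so
it is below `t` exactly if `t` has a one there. -/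
lemma thr_branchPoint {b : ℕ} (t : Bits b) (j : Fin b) : thr t (branchPoint t j) = !t j := by
  have h : Bits.val (branchPoint t j) < Bits.val t ↔ t j = true := by
    rw [Bits.val_lt_val_iff]
    constructor
    · rintro ⟨i, h1, h2, h3⟩
      rcases lt_trichotomy i j with hij | rfl | hij
      · simp [branchPoint, hij, h1] at h2
      · exact h1
      · simp [branchPoint, hij, hij.le.not_gt] at h2
    · intro hj
      exact ⟨j, hj, by simp [branchPoint], fun i hi => by simp [branchPoint, hi]⟩
  unfold thr
  cases hj : t j
  · simpa [hj] using h
  · simpa [hj] using h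

lemma branchPoint_congr {b : ℕ} {t t' : Bits b} {j : Fin b} (h : ∀ i < j, t i = t' i) :
    branchPoint t j = branchPoint t' j := by
  funext i
  unfold branchPoint
  split_ifs with hi
  · exact h i hi
  · rfl

/-- The levels at which the hypothesis `h` errs on the branch points of `t`. -/
def branchErrors {b : ℕ} (h : Bits b → Bool) (t : Bits b) : Bits b := fun j =>
  decide (h (branchPoint t j) ≠ thr t (branchPoint t j))

/-- Once the bits before `j` are known, so are the branch point and the value of `h` there, and the
error bit then reveals `t j`. Thus the error pattern determines `t` bit by bit. -/
lemma branchErrors_bijective {b : ℕ} (h : Bits b → Bool) :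
    Function.Bijective (branchErrors h) := by
  refine Finite.injective_iff_bijective.1 fun t t' htt => ?_
  have key : ∀ (s : ℕ) (j : Fin b), (j : ℕ) = s → t j = t' j := by
    intro s
    induction s using Nat.strong_induction_on with
    | _ s ih =>
      intro j hj
      have h1 : branchPoint t j = branchPoint t' j := branchPoint_congr fun i hi =>
        ih i (hj ▸ hi) i rfl
      have h2 := congrFun htt j
      simp only [branchErrors, thr_branchPoint] at h2
      rw [h1] at h2
      revert h2
      cases t j <;> cases t' j <;> cases h (branchPoint t' j) <;> simp
  exact funext fun j => key j j rfl

lemma sum_pow_card_true (b : ℕ) (s : ℝ) :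
    ∑ d : Bits b, s ^ (Finset.univ.filter fun j => d j = true).card = (1 + s) ^ b := by
  let f (_ : Fin b) (a : Bool) : ℝ := if a = true then s else 1
  have h : ∀ d : Bits b, s ^ (Finset.univ.filter fun j => d j = true).card =
      ∏ j, f j (d j) := by
    intro d
    simp only [f]
    rw [Finset.prod_ite, Finset.prod_const_one, mul_one, Finset.prod_const]
  rw [Finset.sum_congr rfl fun d _ => h d, Bits.sum_prod]
  simp [f, add_comm]

/-- Every hypothesis errs on at most a quarter of the branch points for few thresholds only. -/
lemma card_branchErrors_le {b : ℕ} (h : Bits b → Bool) :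
    ((Finset.univ.filter fun t : Bits b =>
      4 * (Finset.univ.filter fun j => branchErrors h t j = true).card ≤ b).card : ℝ)
      ≤ (3 / 2) ^ b * 2 ^ ((b : ℝ) / 4) := by
  -- Exponential Markov bound: by bijectivity the sum runs over all patterns and factorizes, and
  -- each counted `t` contributes at least `2 ^ (-b / 4)`.
  have h1 : ∑ t : Bits b, (1 / 2 : ℝ) ^ (Finset.univ.filter fun j =>
      branchErrors h t j = true).card = (3 / 2) ^ b := by
    rw [(branchErrors_bijective h).sum_comp
      fun d : Bits b => (1 / 2 : ℝ) ^ (Finset.univ.filter fun j => d j = true).card,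
      sum_pow_card_true]
    norm_num
  rw [← h1, Finset.sum_mul, Finset.card_eq_sum_ones, Finset.sum_filter]
  push_cast
  refine Finset.sum_le_sum fun t _ => ?_
  split_ifs with ht
  · rw [one_div, inv_pow, ← Real.rpow_natCast, ← Real.rpow_neg (by norm_num),
      ← Real.rpow_add (by norm_num)]
    refine Real.one_le_rpow (by norm_num) ?_
    have : (4 : ℝ) * ((Finset.univ.filter fun j => branchErrors h t j = true).card : ℝ) ≤ b := by
      exact_mod_cast ht
    linarith
  · positivity

/-- The uniform distribution on the branch points of `t`. -/
noncomputable def branchMeasure {b : ℕ} (c : ℕ) (t : Bits b) : Measure (Bits c × Bits b) :=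
  (ProbabilityTheory.uniformOn (Set.univ : Set (Fin b))).map
    fun j => ((fun _ => false : Bits c), branchPoint t j)

instance {b c : ℕ} [NeZero b] (t : Bits b) : IsProbabilityMeasure (branchMeasure c t) := by
  have : IsProbabilityMeasure (ProbabilityTheory.uniformOn (Set.univ : Set (Fin b))) :=
    ProbabilityTheory.isProbabilityMeasure_uniformOn Set.finite_univ Set.univ_nonempty
  exact Measure.isProbabilityMeasure_map (by fun_prop)

lemma par_zero_left {c : ℕ} (x : Bits c) : par (fun _ => false) x = false := by simp [par]

lemma genError_branchMeasure {b c : ℕ} [NeZero b] (t : Bits b) (h : Bits c × Bits b → Bool) :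
    genError (branchMeasure c t) (fun z => xor (par (fun _ => false) z.1) (thr t z.2)) h =
      ((Finset.univ.filter fun j =>
        branchErrors (fun y => h (fun _ => false, y)) t j = true).card : ℝ) / b := by
  unfold genError branchMeasure
  rw [map_measureReal_apply (by fun_prop) (Set.toFinite _).measurableSet, measureReal_def,
    ProbabilityTheory.uniformOn_univ, Set.preimage_ofPred_eq]
  rw [Measure.count_apply (Set.toFinite _).measurableSet, ENNReal.toReal_div]
  simp [branchErrors, par_zero_left, Set.encard_eq_coe_toFinset_card]

/-! ### The referee of a curator protocol as an adversary -/

namespace Protocol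

/-- The referee of a curator protocol, seen as an adversary of the curator. -/
def refereeAdversary {M : ℕ} {Z O : Type} [MeasurableSpace O] (P : CuratorProtocol M Z O) :
    Adversary where
  Coins := P.RefCoins
  law := P.refLaw
  query a replies := P.query a (replies.map fun r _ => r) ()
  measurable_query _ := P.measurable_query _ ()
  Out := O
  output a replies := P.output a (replies.map fun r _ => r)
  measurable_output _ := P.measurable_output _

lemma run_eq_interact {M : ℕ} {Z O : Type} [MeasurableSpace O] (P : CuratorProtocol M Z O)
    (x : Unit → Fin M → Z) (ω : (i : Unit) → (P.party i).Coins) (ρ : P.RefCoins) (t : ℕ) :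
    P.run x ω ρ t =
      (fun _ => ((P.party ()).interact P.refereeAdversary (x ()) (ω ()) ρ t).1,
        ((P.party ()).interact P.refereeAdversary (x ()) (ω ()) ρ t).2.map fun r _ => r) := by
  induction t with
  | zero => rfl
  | succ t ih =>
    simp only [run, ih, Party.interact]
    rfl

lemma outcome_eq_output {M : ℕ} {Z O : Type} [MeasurableSpace O] (P : CuratorProtocol M Z O)
    (x : Unit → Fin M → Z) (ω : (i : Unit) → (P.party i).Coins) (ρ : P.RefCoins) :
    P.outcome x ω ρ = P.refereeAdversary.output ρ
      ((P.party ()).interact P.refereeAdversary (x ()) (ω ()) ρ P.rounds).2 := by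
  unfold outcome
  rw [run_eq_interact]
  rfl

lemma advProb_refereeAdversary {M : ℕ} {Z O : Type} [MeasurableSpace O] [MeasurableSpace Z]
    [MeasurableSingletonClass Z] [Countable Z] (P : CuratorProtocol M Z O) (x : Fin M → Z)
    {T : Set O} (hT : MeasurableSet T) :
    (P.party ()).advProb P.rounds P.refereeAdversary x T =
      ((Measure.pi fun i : Unit => (P.party i).law).prod P.refLaw).real
        {s | P.outcome (fun _ => x) s.1 s.2 ∈ T} := by
  have hmeas : Measurable fun s : (P.party ()).Coins × P.RefCoins =>
      P.outcome (fun _ => x) (fun _ => s.1) s.2 :=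
    P.measurable_outcome.comp (f := fun s : (P.party ()).Coins × P.RefCoins =>
      ((fun _ => x, fun _ => s.1, s.2) : P.Sample)) (by fun_prop)
  have hpres := (measurePreserving_eval (fun i : Unit => (P.party i).law) ()).prod
    (MeasurePreserving.id P.refLaw)
  simp only [Party.advProb, measureReal_def]
  congr 1
  simp only [outcome_eq_output] at hmeas ⊢
  exact (hpres.measure_preimage (hmeas hT).nullMeasurableSet).symm

end Protocol

lemma measureReal_prod_le_of_forall {α β : Type*} [MeasurableSpace α] [MeasurableSpace β]
    (μ : Measure α) (ν : Measure β) [IsProbabilityMeasure μ] [IsProbabilityMeasure ν]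
    {E : Set (α × β)} (hE : MeasurableSet E) {C : ℝ}
    (h : ∀ x, ν.real (Prod.mk x ⁻¹' E) ≤ C) : (μ.prod ν).real E ≤ C := by
  have hC : 0 ≤ C := by
    obtain ⟨x⟩ := μ.nonempty_of_neZero
    exact measureReal_nonneg.trans (h x)
  refine ENNReal.toReal_le_of_le_ofReal hC ?_
  rw [Measure.prod_apply hE]
  calc ∫⁻ x, ν (Prod.mk x ⁻¹' E) ∂μ ≤ ∫⁻ _, ENNReal.ofReal C ∂μ := by
        refine lintegral_mono fun x => ?_
        rw [← ofReal_measureReal]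
        exact ENNReal.ofReal_le_ofReal (h x)
    _ = ENNReal.ofReal C := by simp

/-- A private learner in the curator model needs a number of samples that is linear in the number
of bits of the threshold. -/
theorem curator_lower_bound {b c M : ℕ} [NeZero b]
    (P : CuratorProtocol M ((Bits c × Bits b) × Bool) (Bits c × Bits b → Bool))
    (hP : P.IsPrivateLearner) :
    (3 / 4 : ℝ) * 2 ^ b ≤ Real.exp (M / 4) * ((3 / 2) ^ b * 2 ^ ((b : ℝ) / 4)) := by
  obtain ⟨hdp, hpac⟩ := hP
  let f : Bits b → Bits c × Bits b → Bool := fun t z =>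
    xor (par (fun _ => false) z.1) (thr t z.2)
  let T : Bits b → Set (Bits c × Bits b → Bool) := fun t =>
    {h | genError (branchMeasure c t) (f t) h ≤ 1 / 4}
  have hT : ∀ t, MeasurableSet (T t) := fun t => (Set.toFinite _).measurableSet
  -- Any fixed database would do; group privacy compares all executions with the one on `x₀`.
  let x₀ : Fin M → (Bits c × Bits b) × Bool := fun _ => ((fun _ => false, fun _ => false), false)
  let ν := (Measure.pi fun i : Unit => (P.party i).law).prod P.refLaw
  have hgroup : ∀ t x, ν.real {s | P.outcome (fun _ => x) s.1 s.2 ∈ T t} ≤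
      Real.exp (M / 4) * ν.real {s | P.outcome (fun _ => x₀) s.1 s.2 ∈ T t} := by
    intro t x
    rw [← P.advProb_refereeAdversary x (hT t), ← P.advProb_refereeAdversary x₀ (hT t)]
    have := le_exp_mul_of_neighboring
      (fun x => (P.party ()).advProb P.rounds P.refereeAdversary x (T t)) (1 / 4)
      (fun x x' hx => by simpa using hdp () P.refereeAdversary x x' hx (T t) (hT t)) x x₀
    convert this using 3
    ring
  have hone : ∀ t, 3 / 4 ≤
      Real.exp (M / 4) * ν.real {s | P.outcome (fun _ => x₀) s.1 s.2 ∈ T t} := by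
    intro t
    have h1 := hpac (f t) ⟨_, t, rfl⟩ (branchMeasure c t) inferInstance
    refine le_trans (by norm_num) (h1.trans ?_)
    refine measureReal_prod_le_of_forall _ _ ?_ fun x => ?_
    · have hmap : Measurable fun s : (Unit → Fin M → Bits c × Bits b) ×
          ((i : Unit) → (P.party i).Coins) × P.RefCoins =>
          ((fun i j => (s.1 i j, f t (s.1 i j)), s.2) : P.Sample) := by
        refine Measurable.prodMk ?_ measurable_snd
        exact (Measurable.of_discrete (f := fun (d : Unit → Fin M → Bits c × Bits b) i j =>
          (d i j, f t (d i j)))).comp measurable_fst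
      exact (P.measurable_outcome.comp hmap) (hT t)
    · exact hgroup t fun j => (x () j, f t (x () j))
  -- On `x₀` the output has one distribution for all thresholds, and each hypothesis is good for few
  -- of them.
  have hsum : ∑ t, ν.real {s | P.outcome (fun _ => x₀) s.1 s.2 ∈ T t} ≤
      (3 / 2) ^ b * 2 ^ ((b : ℝ) / 4) := by
    refine sum_measureReal_le_of_card_le ν _ (fun t => ?_) _ fun s => ?_
    · exact (P.measurable_outcome.comp (measurable_const.prodMk measurable_id)) (hT t)
    · refine le_trans (le_of_eq ?_) (card_branchErrors_le
        fun y => P.outcome (fun _ => x₀) s.1 s.2 (fun _ => false, y))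
      rw [Finset.card_eq_sum_ones, Finset.sum_filter]
      push_cast
      refine Finset.sum_congr rfl fun t _ => ?_
      rw [Set.indicator_apply]
      refine if_congr ?_ rfl rfl
      have hb : (0 : ℝ) < b := by exact_mod_cast Nat.pos_of_neZero b
      simp only [T, f, Set.mem_ofPred_eq, genError_branchMeasure]
      rw [div_le_iff₀ hb, ← Nat.cast_le (α := ℝ)]
      push_cast
      constructor <;> intro h <;> linarith
  calc (3 / 4 : ℝ) * 2 ^ b = ∑ _t : Bits b, (3 / 4 : ℝ) := by simp [mul_comm]
    _ ≤ ∑ t, Real.exp (M / 4) * ν.real {s | P.outcome (fun _ => x₀) s.1 s.2 ∈ T t} :=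
      Finset.sum_le_sum fun t _ => hone t
    _ ≤ _ := by rw [← Finset.mul_sum]; gcongr

/-! ## A lower bound for the local model -/

lemma measureReal_prod_eq_integral {α β : Type*} [MeasurableSpace α] [MeasurableSpace β]
    (μ : Measure α) (ν : Measure β) [IsProbabilityMeasure μ] [IsProbabilityMeasure ν]
    {E : Set (α × β)} (hE : MeasurableSet E) :
    (μ.prod ν).real E = ∫ x, ν.real (Prod.mk x ⁻¹' E) ∂μ := by
  simp only [measureReal_def]
  rw [Measure.prod_apply hE, integral_toReal (measurable_measure_prodMk_left hE).aemeasurable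
    (ae_of_all _ fun x => measure_lt_top _ _)]

lemma integral_uniformOn_univ {α : Type*} [Fintype α] [MeasurableSpace α]
    [MeasurableSingletonClass α] (g : α → ℝ) :
    ∫ a, g a ∂(ProbabilityTheory.uniformOn (Set.univ : Set α)) =
      (∑ a, g a) / Fintype.card α := by
  rw [ProbabilityTheory.uniformOn, ProbabilityTheory.cond, Measure.restrict_univ,
    integral_smul_measure, integral_count, Measure.count_apply MeasurableSet.univ]
  simp [Set.encard_univ, div_eq_inv_mul]

/-- Weierstrass' product inequality, with factors on either side of `1`. Applied to the likelihood
ratios of the agents, it bounds the likelihood ratio of a transcript from below. -/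
lemma one_sub_sum_abs_le_prod {ι : Type*} (s : Finset ι) (u : ι → ℝ) (hu : ∀ i, 0 ≤ u i) :
    1 - ∑ i ∈ s, |u i - 1| ≤ ∏ i ∈ s, u i := by
  induction s using Finset.cons_induction with
  | empty => simp
  | cons a s ha ih =>
    rw [Finset.sum_cons, Finset.prod_cons]
    have h0 : 0 ≤ ∏ i ∈ s, u i := Finset.prod_nonneg fun i _ => hu i
    have h1 : 0 ≤ ∑ i ∈ s, |u i - 1| := Finset.sum_nonneg fun i _ => abs_nonneg _
    rcases le_total 1 (u a) with h | h
    · rw [abs_of_nonneg (by linarith)]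
      nlinarith
    · rw [abs_of_nonpos (by linarith)]
      rcases le_total 1 (∑ i ∈ s, |u i - 1|) with h2 | h2
      · have := mul_nonneg (hu a) h0
        linarith
      · nlinarith [hu a]

/-- If the point masses of `μ` are at most those of `ν` up to a relative error `A`, then `μ` is
close to `ν` on every set. -/
lemma measureReal_le_add_integral {α : Type*} [Countable α] [MeasurableSpace α]
    [MeasurableSingletonClass α] (μ ν : Measure α) [IsProbabilityMeasure μ]
    [IsProbabilityMeasure ν] (A : α → ℝ) (hA : ∀ a, 0 ≤ A a) (C : ℝ) (hC : ∀ a, A a ≤ C)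
    (h : ∀ a, μ.real {a} ≤ ν.real {a} + A a * μ.real {a}) (S : Set α) :
    μ.real S ≤ ν.real S + ∫ a, A a ∂μ := by
  have hint : Integrable A μ := by
    refine Integrable.of_bound (Measurable.of_discrete).aestronglyMeasurable C
      (ae_of_all _ fun a => ?_)
    rw [Real.norm_of_nonneg (hA a)]
    exact hC a
  have h1 : μ S ≤ ν S + ∫⁻ a, ENNReal.ofReal (A a) ∂μ := by
    have hS : MeasurableSet S := S.to_countable.measurableSet
    rw [← μ.tsum_indicator_apply_singleton S hS, ← ν.tsum_indicator_apply_singleton S hS,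
      lintegral_countable', ← ENNReal.tsum_add]
    refine ENNReal.tsum_le_tsum fun a => ?_
    by_cases ha : a ∈ S
    · simp only [Set.indicator_of_mem ha]
      rw [← ofReal_measureReal (μ := μ), ← ofReal_measureReal (μ := ν),
        ← ENNReal.ofReal_mul (hA a), ← ENNReal.ofReal_add (by positivity)
          (mul_nonneg (hA a) (by positivity))]
      exact ENNReal.ofReal_le_ofReal (h a)
    · simp [ha]
  rw [← ofReal_integral_eq_lintegral_ofReal hint (ae_of_all _ hA),
    ← ofReal_measureReal (μ := μ), ← ofReal_measureReal (μ := ν),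
    ← ENNReal.ofReal_add (by positivity) (integral_nonneg hA)] at h1
  exact (ENNReal.ofReal_le_ofReal_iff (add_nonneg (by positivity) (integral_nonneg hA))).1 h1

/-- Conditioning on a parity changes the mean of a function with small multiplicative variation
little for most parities. -/
lemma sum_abs_parity_mean_sub_le {c : ℕ} (w : Bits c × Bool → ℝ)
    (hw2 : ∀ z z', w z ≤ 2 * w z') :
    ∑ k : Bits c, |(∑ x, w (x, xor (par k x) true)) / 2 ^ c - (∑ z, w z) / 2 ^ (c + 1)| ≤
      √(2 ^ c) * ((∑ z, w z) / 2 ^ (c + 1)) := by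
  have hw : ∀ z, 0 ≤ w z := fun z => by have := hw2 z z; linarith
  set W := (∑ z, w z) / 2 ^ (c + 1) with hW
  have hW0 : 0 ≤ W := div_nonneg (Finset.sum_nonneg fun z _ => hw z) (by positivity)
  have hcard : (Fintype.card (Bits c × Bool) : ℝ) = 2 ^ (c + 1) := by
    simp [pow_succ]
  have hmax : ∀ z, w z ≤ 2 * W := by
    intro z
    rw [hW, ← mul_div_assoc, le_div_iff₀ (by positivity), ← hcard, Finset.mul_sum]
    calc w z * (Fintype.card (Bits c × Bool) : ℝ) = ∑ _z' : Bits c × Bool, w z := by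
          simp [mul_comm]
      _ ≤ _ := Finset.sum_le_sum fun z' _ => hw2 z z'
  -- The part of `w` that depends on the label. Both values of `w` lie in `[0, 2 * W]`, whence `|v|
  -- ≤ W`.
  let v : Bits c → ℝ := fun x => (w (x, true) - w (x, false)) / 2
  have hv : ∀ x, v x ^ 2 ≤ W ^ 2 := by
    intro x
    refine sq_le_sq' ?_ ?_ <;>
    · have h1 := hmax (x, true)
      have h2 := hmax (x, false)
      have h3 := hw (x, true)
      have h4 := hw (x, false)
      simp only [v]
      linarith
  -- The label-independent part averages to `W` and cancels; a Fourier coefficient of `v` remains.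
  -- Parseval and Cauchy–Schwarz finish the proof.
  have hdiff : ∀ k : Bits c, (∑ x, w (x, xor (par k x) true)) / 2 ^ c - W =
      (∑ x, v x * sgn (par k x)) / 2 ^ c := by
    intro k
    have h1 : ∑ x, w (x, xor (par k x) true) =
        ∑ x, v x * sgn (par k x) + (∑ z, w z) / 2 := by
      rw [Fintype.sum_prod_type, Finset.sum_div, ← Finset.sum_add_distrib]
      refine Finset.sum_congr rfl fun x _ => ?_
      simp only [v, Fintype.sum_bool]
      cases par k x <;> simp [sgn] <;> ring
    rw [h1, hW, pow_succ]
    field_simp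
    ring
  have hsq : ∑ k : Bits c, |(∑ x, v x * sgn (par k x)) / 2 ^ c| ^ 2 ≤ W ^ 2 := by
    simp_rw [sq_abs, div_pow]
    rw [← Finset.sum_div, sum_sq_fourier, div_le_iff₀ (by positivity)]
    calc (2 : ℝ) ^ c * ∑ x, v x ^ 2 ≤ 2 ^ c * ∑ _x : Bits c, W ^ 2 :=
          mul_le_mul_of_nonneg_left (Finset.sum_le_sum fun x _ => hv x) (by positivity)
      _ = W ^ 2 * (2 ^ c) ^ 2 := by simp; ring
  simp_rw [hdiff]
  refine abs_le_of_sq_le_sq' ?_ (by positivity) |>.2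
  calc _ ≤ ((Finset.univ : Finset (Bits c)).card : ℝ) *
        ∑ k : Bits c, |(∑ x, v x * sgn (par k x)) / 2 ^ c| ^ 2 := sq_sum_le_card_mul_sum_sq
    _ ≤ 2 ^ c * W ^ 2 := by
        simp only [Finset.card_univ, Fintype.card_pi, Fintype.card_bool, Finset.prod_const,
          Fintype.card_fin, Nat.cast_pow, Nat.cast_ofNat]
        gcongr
    _ = (√(2 ^ c) * W) ^ 2 := by rw [mul_pow, Real.sq_sqrt (by positivity)]

/-- At most four parities are close to a given function. -/
lemma card_close_parities_le {c : ℕ} (h : Bits c → Bool) :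
    (Finset.univ.filter fun k : Bits c =>
      ((Finset.univ.filter fun x => h x ≠ xor (par k x) true).card : ℝ) / 2 ^ c ≤ 1 / 4).card
      ≤ 4 := by
  set G := Finset.univ.filter fun k : Bits c =>
      ((Finset.univ.filter fun x => h x ≠ xor (par k x) true).card : ℝ) / 2 ^ c ≤ 1 / 4 with hG
  -- The negation matches the labels `xor (par k x) true`. An error of at most `1 / 4` means
  -- correlation at least `1 / 2`, and Parseval allows at most four such coefficients.
  let v : Bits c → ℝ := fun x => sgn (xor (h x) true)
  have hcoef : ∀ k ∈ G, ((2 : ℝ) ^ c / 2) ^ 2 ≤ (∑ x, v x * sgn (par k x)) ^ 2 := by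
    intro k hk
    have hk' := (Finset.mem_filter.1 hk).2
    rw [div_le_iff₀ (by positivity)] at hk'
    have h1 : ∑ x, v x * sgn (par k x) = 2 ^ c -
        2 * ((Finset.univ.filter fun x => h x ≠ xor (par k x) true).card : ℝ) := by
      rw [Finset.card_eq_sum_ones, Finset.sum_filter]
      push_cast
      have h2 : (2 : ℝ) ^ c = ∑ _x : Bits c, (1 : ℝ) := by simp
      rw [h2, Finset.mul_sum, ← Finset.sum_sub_distrib]
      refine Finset.sum_congr rfl fun x _ => ?_
      simp only [v]
      cases h x <;> cases par k x <;> simp [sgn] <;> norm_num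
    rw [h1]
    refine pow_le_pow_left₀ (by positivity) ?_ 2
    linarith
  have h2 : (G.card : ℝ) * (2 ^ c / 2) ^ 2 ≤ 2 ^ c * 2 ^ c := by
    calc (G.card : ℝ) * (2 ^ c / 2) ^ 2 = ∑ _k ∈ G, ((2 : ℝ) ^ c / 2) ^ 2 := by simp
      _ ≤ ∑ k ∈ G, (∑ x, v x * sgn (par k x)) ^ 2 := Finset.sum_le_sum hcoef
      _ ≤ ∑ k, (∑ x, v x * sgn (par k x)) ^ 2 :=
        Finset.sum_le_sum_of_subset_of_nonneg (Finset.subset_univ _) fun _ _ _ => sq_nonneg _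
      _ = 2 ^ c * 2 ^ c := by
        rw [sum_sq_fourier]
        simp [v, sq, sgn_mul_self]
  have h3 : (G.card : ℝ) ≤ 4 := by
    have h4 : (0 : ℝ) < 2 ^ c * 2 ^ c := by positivity
    nlinarith
  exact_mod_cast h3

/-! ### Transcripts for fixed coins of the referee -/

namespace Protocol

variable {ι : Type} {ℓ : ι → ℕ} {Z O : Type} [MeasurableSpace O]

/-- The messages that party `i` has received when it answers after the replies `π`. -/
def received (P : Protocol ι ℓ Z O) (ρ : P.RefCoins) (i : ι) : List (ι → Msg) → List Msg
  | [] => [P.query ρ [] i]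
  | r :: π => P.query ρ (r :: π) i :: P.received ρ i π

/-- The input `x` and the coins `ω` of party `i` lead to its replies in `π`, if the referee asks
what it asks when the replies are `π`. -/
def Consistent (P : Protocol ι ℓ Z O) (ρ : P.RefCoins) (i : ι) (x : Fin (ℓ i) → Z)
    (ω : (P.party i).Coins) : List (ι → Msg) → Prop
  | [] => True
  | r :: π => P.Consistent ρ i x ω π ∧ (P.party i).next x ω (P.received ρ i π) = r i

lemma query_cons_run (P : Protocol ι ℓ Z O) (x : (i : ι) → Fin (ℓ i) → Z)
    (ω : (i : ι) → (P.party i).Coins) (ρ : P.RefCoins) (t : ℕ) (i : ι) :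
    P.query ρ (P.run x ω ρ t).2 i :: (P.run x ω ρ t).1 i = P.received ρ i (P.run x ω ρ t).2 := by
  induction t with
  | zero => rfl
  | succ t ih => simp only [run, received, ih]

/-- The rectangle property: a transcript fixes all queries, so its occurrence is a separate
condition on the input and the coins of each party. -/
lemma run_eq_iff (P : Protocol ι ℓ Z O) (x : (i : ι) → Fin (ℓ i) → Z)
    (ω : (i : ι) → (P.party i).Coins) (ρ : P.RefCoins) (t : ℕ) (π : List (ι → Msg)) :
    (P.run x ω ρ t).2 = π ↔ π.length = t ∧ ∀ i, P.Consistent ρ i (x i) (ω i) π := by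
  induction t generalizing π with
  | zero =>
    cases π with
    | nil => simp [run, Consistent]
    | cons r π => simp [run]
  | succ t ih =>
    cases π with
    | nil => simp [run]
    | cons r π =>
      simp only [run, query_cons_run, List.cons.injEq, List.length_cons, Nat.add_right_cancel_iff,
        Consistent, forall_and]
      constructor
      · rintro ⟨h1, h2⟩
        have h3 := (ih π).1 h2
        exact ⟨h3.1, h3.2, fun i => by rw [← h1, h2]⟩
      · rintro ⟨h1, h2, h3⟩
        have h4 := (ih π).2 ⟨h1, h2⟩
        exact ⟨funext fun i => by rw [h4, h3], h4⟩

lemma measurableSet_consistent (P : Protocol ι ℓ Z O) (ρ : P.RefCoins) (i : ι)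
    (x : Fin (ℓ i) → Z) (π : List (ι → Msg)) :
    MeasurableSet {ω | P.Consistent ρ i x ω π} := by
  induction π with
  | nil => simp [Consistent]
  | cons r π ih =>
    exact ih.inter ((P.party i).measurable_next x _ (measurableSet_singleton (r i)))

/-- The probability that party `i` with input `x` gives its replies in `π`. -/
noncomputable def replyProb (P : Protocol ι ℓ Z O) (ρ : P.RefCoins) (i : ι) (π : List (ι → Msg))
    (x : Fin (ℓ i) → Z) : ℝ :=
  (P.party i).law.real {ω | P.Consistent ρ i x ω π}

/-- The adversary that sends the messages of the referee in the execution with replies `π`. -/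
noncomputable def scriptAdversary (P : Protocol ι ℓ Z O) (ρ : P.RefCoins) (i : ι)
    (π : List (ι → Msg)) : Adversary where
  Coins := Unit
  law := Measure.dirac ()
  query _ replies := P.query ρ (π.drop (π.length - replies.length)) i
  measurable_query _ := measurable_const
  Out := List Msg
  output _ replies := replies
  measurable_output _ := measurable_const

/-- The adversary reads off the round from the number of replies and asks along `π`, whatever the
replies are. Hence the length must be carried through the induction: it makes `List.drop` return the
right suffix. -/
lemma interact_scriptAdversary (P : Protocol ι ℓ Z O) (ρ : P.RefCoins) (i : ι)
    (π : List (ι → Msg)) (x : Fin (ℓ i) → Z) (ω : (P.party i).Coins) (σ : List (ι → Msg))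
    (hσ : σ <:+ π) :
    ((P.party i).interact (P.scriptAdversary ρ i π) x ω () σ.length).2.length = σ.length ∧
    P.query ρ σ i :: ((P.party i).interact (P.scriptAdversary ρ i π) x ω () σ.length).1 =
      P.received ρ i σ ∧
    (((P.party i).interact (P.scriptAdversary ρ i π) x ω () σ.length).2 = σ.map (fun r => r i) ↔
      P.Consistent ρ i x ω σ) := by
  induction σ with
  | nil => exact ⟨rfl, rfl, by simp [Party.interact, Consistent]⟩
  | cons r σ ih =>
    have hσ' : σ <:+ π := (List.suffix_cons r σ).trans hσ
    obtain ⟨h1, h2, h3⟩ := ih hσ'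
    have hq : (P.scriptAdversary ρ i π).query ()
        ((P.party i).interact (P.scriptAdversary ρ i π) x ω () σ.length).2 = P.query ρ σ i := by
      simp only [scriptAdversary] at h1 ⊢
      rw [h1, ← List.suffix_iff_eq_drop.1 hσ']
    simp only [List.length_cons, Party.interact, hq, h2, h1, received, List.map_cons,
      List.cons.injEq, Consistent, true_and, h3]
    exact and_comm

/-- Privacy against the adversary that follows the script `π`. The length of `π` matters because the
definition of privacy concerns the full number of rounds. -/
lemma replyProb_le (P : Protocol ι ℓ Z O) {ε : ℝ} (hP : P.IsDP ε) (ρ : P.RefCoins) (i : ι)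
    {π : List (ι → Msg)} (hπ : π.length = P.rounds) {x x' : Fin (ℓ i) → Z}
    (hx : Neighboring x x') :
    P.replyProb ρ i π x ≤ Real.exp ε * P.replyProb ρ i π x' := by
  have key : ∀ x, (P.party i).advProb P.rounds (P.scriptAdversary ρ i π) x
      {π.map fun r => r i} = P.replyProb ρ i π x := by
    intro x
    simp only [Party.advProb, replyProb, measureReal_def]
    congr 1
    have hset : {s : (P.party i).Coins × Unit | (P.scriptAdversary ρ i π).output s.2
        ((P.party i).interact (P.scriptAdversary ρ i π) x s.1 s.2 P.rounds).2 ∈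
          ({π.map fun r => r i} : Set (List Msg))} =
        {ω | P.Consistent ρ i x ω π} ×ˢ Set.univ := by
      ext ⟨ω, u⟩
      rw [← hπ]
      have := (P.interact_scriptAdversary ρ i π x ω π List.suffix_rfl).2.2
      exact Iff.trans Iff.rfl (this.trans (by simp))
    refine (congrArg _ hset).trans ((Measure.prod_prod _ _).trans ?_)
    exact (congrArg _ measure_univ).trans (mul_one _)
  have := hP i (P.scriptAdversary ρ i π) x x' hx {π.map fun r => r i} trivial
  simpa [key] using this

/-- The transcripts of a protocol on independent inputs have a product form. -/
lemma measureReal_run_eq [Fintype ι] (P : Protocol ι ℓ Z O) (ρ : P.RefCoins) {E : ι → Type}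
    [∀ i, MeasurableSpace (E i)] [∀ i, Countable (E i)] [∀ i, MeasurableSingletonClass (E i)]
    (μ : (i : ι) → Measure (E i)) [∀ i, IsProbabilityMeasure (μ i)]
    (d : (i : ι) → E i → Fin (ℓ i) → Z) {π : List (ι → Msg)} (hπ : π.length = P.rounds) :
    ((Measure.pi μ).prod (Measure.pi fun i => (P.party i).law)).real
        {s | (P.run (fun i => d i (s.1 i)) s.2 ρ P.rounds).2 = π} =
      ∏ i, ∫ e, P.replyProb ρ i π (d i e) ∂(μ i) := by
  simp only [run_eq_iff, hπ, true_and]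
  have hmeas : MeasurableSet {s : ((i : ι) → E i) × ((i : ι) → (P.party i).Coins) |
      ∀ i, P.Consistent ρ i (d i (s.1 i)) (s.2 i) π} := by
    have : ∀ i, Measurable fun s : ((i : ι) → E i) × ((i : ι) → (P.party i).Coins) =>
        P.Consistent ρ i (d i (s.1 i)) (s.2 i) π := fun i =>
      Measurable.eval_countable (β := E i)
        (g := fun (s : ((i : ι) → E i) × ((i : ι) → (P.party i).Coins)) e =>
          P.Consistent ρ i (d i e) (s.2 i) π)
        (fun e => (measurableSet_setOfPred.1 (P.measurableSet_consistent ρ i (d i e) π)).comp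
          ((measurable_pi_apply i).comp measurable_snd))
        ((measurable_pi_apply i).comp measurable_fst)
    exact measurableSet_setOfPred.2 (Measurable.forall this)
  rw [measureReal_prod_eq_integral _ _ hmeas, ← integral_fintype_prod_eq_prod
    (f := fun i e => P.replyProb ρ i π (d i e))]
  congr 1
  funext e
  have hset : Prod.mk e ⁻¹' {s : ((i : ι) → E i) × ((i : ι) → (P.party i).Coins) |
      ∀ i, P.Consistent ρ i (d i (s.1 i)) (s.2 i) π} =
      Set.pi Set.univ fun i => {ω | P.Consistent ρ i (d i (e i)) ω π} := by
    ext ω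
    simp
  rw [hset, measureReal_def, Measure.pi_pi, ENNReal.toReal_prod]
  rfl

lemma measurable_transcript [Fintype ι] [MeasurableSpace Z] [MeasurableSingletonClass Z]
    [Countable Z] (P : Protocol ι ℓ Z O) (ρ : P.RefCoins) {E : ι → Type}
    [∀ i, MeasurableSpace (E i)] [∀ i, Countable (E i)] [∀ i, MeasurableSingletonClass (E i)]
    (d : (i : ι) → E i → Fin (ℓ i) → Z) :
    Measurable fun s : ((i : ι) → E i) × ((i : ι) → (P.party i).Coins) =>
      (P.run (fun i => d i (s.1 i)) s.2 ρ P.rounds).2 := by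
  refine (P.measurable_run P.rounds).snd.comp
    (f := fun s : ((i : ι) → E i) × ((i : ι) → (P.party i).Coins) =>
      ((fun i => d i (s.1 i), s.2, ρ) : P.Sample)) ?_
  refine Measurable.prodMk ?_ (measurable_snd.prodMk measurable_const)
  exact measurable_pi_lambda _ fun i =>
    (Measurable.of_discrete (f := d i)).comp ((measurable_pi_apply i).comp measurable_fst)

end Protocol

/-! ### Parities cannot be told apart by few private agents -/

section LocalModel

variable {b c N : ℕ}

/-- The distribution of `(x, 0)` for uniform `x`. -/
noncomputable def parityMeasure (c b : ℕ) : Measure (Bits c × Bits b) :=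
  (ProbabilityTheory.uniformOn (Set.univ : Set (Bits c))).map fun x => (x, fun _ => false)

instance {α : Type*} [Fintype α] [Nonempty α] [MeasurableSpace α] [MeasurableSingletonClass α] :
    IsProbabilityMeasure (ProbabilityTheory.uniformOn (Set.univ : Set α)) :=
  ProbabilityTheory.isProbabilityMeasure_uniformOn Set.finite_univ Set.univ_nonempty

instance : IsProbabilityMeasure (parityMeasure c b) :=
  Measure.isProbabilityMeasure_map (by fun_prop)

/-- The concept with parity `k` and threshold `0`. -/
def parityConcept (b : ℕ) (k : Bits c) : Bits c × Bits b → Bool := fun z =>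
  xor (par k z.1) (thr (fun _ => false) z.2)

lemma parityConcept_zero (k x : Bits c) :
    parityConcept b k (x, fun _ => false) = xor (par k x) true := by
  simp [parityConcept, thr]

lemma genError_parityMeasure (k : Bits c) (h : Bits c × Bits b → Bool) :
    genError (parityMeasure c b) (parityConcept b k) h =
      ((Finset.univ.filter fun x : Bits c =>
        h (x, fun _ => false) ≠ xor (par k x) true).card : ℝ) / 2 ^ c := by
  unfold genError parityMeasure
  rw [map_measureReal_apply (by fun_prop) (Set.toFinite _).measurableSet, measureReal_def,
    ProbabilityTheory.uniformOn_univ, Set.preimage_ofPred_eq]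
  rw [Measure.count_apply (Set.toFinite _).measurableSet, ENNReal.toReal_div]
  simp [parityConcept_zero, Set.encard_eq_coe_toFinset_card]

lemma integral_pi_parityMeasure (g : (Fin 1 → Bits c × Bits b) → ℝ) :
    ∫ e, g e ∂(Measure.pi fun _ : Fin 1 => parityMeasure c b) =
      (∑ x : Bits c, g fun _ => (x, fun _ => false)) / 2 ^ c := by
  have h1 : ∫ e, g e ∂(Measure.pi fun _ : Fin 1 => parityMeasure c b) =
      ∫ z, g fun _ => z ∂(parityMeasure c b) := by
    conv_rhs => rw [← (measurePreserving_eval (fun _ : Fin 1 => parityMeasure c b) 0).map_eq]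
    rw [integral_map (measurable_pi_apply 0).aemeasurable
        (Measurable.of_discrete).aestronglyMeasurable]
    refine integral_congr_ae (ae_of_all _ fun e => congrArg g (funext fun i => ?_))
    rw [Subsingleton.elim i 0]
  rw [h1, parityMeasure, integral_map (by fun_prop) (Measurable.of_discrete).aestronglyMeasurable,
    integral_uniformOn_univ]
  simp

/-- For fixed coins of the referee, the executions of a private local protocol on the different
parities are too similar for all of them to succeed. -/
lemma sum_success_le (P : LocalProtocol N ((Bits c × Bits b) × Bool) (Bits c × Bits b → Bool))
    (hP : P.IsDP (1 / 4)) (ρ : P.RefCoins) :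
    ∑ k : Bits c, ((Measure.pi fun _ : Fin N => Measure.pi fun _ : Fin 1 =>
        parityMeasure c b).prod (Measure.pi fun i => (P.party i).law)).real
      {s | genError (parityMeasure c b) (parityConcept b k) (P.outcome
        (fun i j => (s.1 i j, parityConcept b k (s.1 i j))) s.2 ρ) ≤ 1 / 4} ≤
      4 + N * √(2 ^ c) := by
  let law := Measure.pi fun i => (P.party i).law
  let d (k : Bits c) (_ : Fin N) (e : Fin 1 → Bits c × Bits b) :
      Fin 1 → (Bits c × Bits b) × Bool := fun j => (e j, parityConcept b k (e j))
  let d₀ (_ : Fin N) (e : Bits c × Bool) : Fin 1 → (Bits c × Bits b) × Bool :=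
    fun _ => ((e.1, fun _ => false), e.2)
  let μ := (Measure.pi fun _ : Fin N => Measure.pi fun _ : Fin 1 => parityMeasure c b).prod law
  -- The reference experiment, with uniform labels independent of the points; it does not depend on
  -- `k`.
  let μ₀ := (Measure.pi fun _ : Fin N =>
    ProbabilityTheory.uniformOn (Set.univ : Set (Bits c × Bool))).prod law
  let T (k : Bits c) := fun s : (Fin N → Fin 1 → Bits c × Bits b) ×
    ((i : Fin N) → (P.party i).Coins) => (P.run (fun i => d k i (s.1 i)) s.2 ρ P.rounds).2
  let T₀ := fun s : (Fin N → Bits c × Bool) × ((i : Fin N) → (P.party i).Coins) =>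
    (P.run (fun i => d₀ i (s.1 i)) s.2 ρ P.rounds).2
  have hT : ∀ k, Measurable (T k) := fun k => P.measurable_transcript ρ (d k)
  have hT₀ : Measurable T₀ := P.measurable_transcript ρ d₀
  let ν (k : Bits c) := μ.map (T k)
  let ν₀ := μ₀.map T₀
  have hν : ∀ k, IsProbabilityMeasure (ν k) := fun k =>
    Measure.isProbabilityMeasure_map (hT k).aemeasurable
  have hν₀ : IsProbabilityMeasure ν₀ := Measure.isProbabilityMeasure_map hT₀.aemeasurable
  let w (π : List (Fin N → Msg)) (i : Fin N) (z : Bits c × Bool) : ℝ :=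
    P.replyProb ρ i π fun _ => ((z.1, fun _ => false), z.2)
  let W (π : List (Fin N → Msg)) (i : Fin N) : ℝ := (∑ z, w π i z) / 2 ^ (c + 1)
  let V (k : Bits c) (π : List (Fin N → Msg)) (i : Fin N) : ℝ :=
    (∑ x, w π i (x, xor (par k x) true)) / 2 ^ c
  have hw0 : ∀ π i z, 0 ≤ w π i z := fun π i z => measureReal_nonneg
  have hw2 : ∀ π, π.length = P.rounds → ∀ i z z', w π i z ≤ 2 * w π i z' := by
    intro π hπ i z z'
    refine (P.replyProb_le hP ρ i hπ (x' := fun _ => ((z'.1, fun _ => false), z'.2)) ?_).trans ?_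
    · exact ⟨0, fun j hj => absurd (Subsingleton.elim j 0) hj⟩
    · refine mul_le_mul_of_nonneg_right ?_ (hw0 π i z')
      have := Real.exp_one_lt_d9
      have h4 : Real.exp (1 / 4) ^ 4 = Real.exp 1 := by rw [← Real.exp_nat_mul]; norm_num
      by_contra! hcon
      have := pow_lt_pow_left₀ hcon (by norm_num) (n := 4) (by norm_num)
      rw [h4] at this
      linarith
  have hW0 : ∀ π i, 0 ≤ W π i := fun π i =>
    div_nonneg (Finset.sum_nonneg fun z _ => hw0 π i z) (by positivity)
  have hν_eq : ∀ k π, π.length = P.rounds → (ν k).real {π} = ∏ i, V k π i := by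
    intro k π hπ
    have h1 : (ν k).real {π} = μ.real {s | T k s = π} :=
      map_measureReal_apply (hT k) (measurableSet_singleton π)
    rw [h1]
    refine (P.measureReal_run_eq ρ (fun _ : Fin N => Measure.pi fun _ : Fin 1 =>
      parityMeasure c b) (d k) hπ).trans ?_
    refine Finset.prod_congr rfl fun i _ => ?_
    rw [integral_pi_parityMeasure]
    simp only [V, w, d, parityConcept_zero]
  have hν₀_eq : ∀ π, π.length = P.rounds → ν₀.real {π} = ∏ i, W π i := by
    intro π hπ
    have h1 : ν₀.real {π} = μ₀.real {s | T₀ s = π} :=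
      map_measureReal_apply hT₀ (measurableSet_singleton π)
    rw [h1]
    refine (P.measureReal_run_eq ρ (fun _ : Fin N =>
      ProbabilityTheory.uniformOn (Set.univ : Set (Bits c × Bool))) d₀ hπ).trans ?_
    refine Finset.prod_congr rfl fun i _ => ?_
    rw [integral_uniformOn_univ]
    simp [W, w, d₀, pow_succ]
  have hν₀_ne : ∀ π, π.length ≠ P.rounds → ν₀.real {π} = 0 := by
    intro π hπ
    have h1 : ν₀.real {π} = μ₀.real {s | T₀ s = π} :=
      map_measureReal_apply hT₀ (measurableSet_singleton π)
    have h2 : {s | T₀ s = π} = ∅ := by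
      ext s
      simp only [T₀, Set.mem_ofPred_eq, Protocol.run_eq_iff, hπ, false_and, Set.mem_empty_iff_false]
    rw [h1, h2, measureReal_empty]
  -- A bound for the relative error of transcript probabilities. Where `W π i = 0` the quotient is
  -- `0` by convention, which is harmless since `π` then has mass zero under `ν₀`. Other lengths get
  -- `0` because `hw2` covers full transcripts only.
  let A (k : Bits c) (π : List (Fin N → Msg)) : ℝ :=
    if π.length = P.rounds then ∑ i, |V k π i - W π i| / W π i else 0
  have hA0 : ∀ k π, 0 ≤ A k π := by
    intro k π
    simp only [A]
    split_ifs
    · exact Finset.sum_nonneg fun i _ => div_nonneg (abs_nonneg _) (hW0 π i)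
    · rfl
  have hsumA : ∀ π, ∑ k, A k π ≤ N * √(2 ^ c) := by
    intro π
    by_cases hπ : π.length = P.rounds
    · simp only [A, hπ, if_true]
      rw [Finset.sum_comm]
      calc ∑ i, ∑ k, |V k π i - W π i| / W π i ≤ ∑ _i : Fin N, √(2 ^ c) := by
            refine Finset.sum_le_sum fun i _ => ?_
            rw [← Finset.sum_div]
            exact div_le_of_le_mul₀ (hW0 π i) (by positivity)
              (sum_abs_parity_mean_sub_le (w π i) (hw2 π hπ i))
        _ = N * √(2 ^ c) := by simp
    · simp only [A, hπ, if_false, Finset.sum_const_zero]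
      positivity
  have hA_le : ∀ k π, A k π ≤ N * √(2 ^ c) := fun k π =>
    (Finset.single_le_sum (f := fun k => A k π) (fun k _ => hA0 k π)
      (Finset.mem_univ k)).trans (hsumA π)
  have hpoint : ∀ k π, ν₀.real {π} ≤ (ν k).real {π} + A k π * ν₀.real {π} := by
    intro k π
    by_cases hπ : π.length = P.rounds
    · rw [hν₀_eq π hπ, hν_eq k π hπ]
      have hV0 : ∀ i, 0 ≤ V k π i := fun i =>
        div_nonneg (Finset.sum_nonneg fun x _ => hw0 π i _) (by positivity)
      by_cases hzero : ∃ i, W π i = 0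
      · obtain ⟨i, hi⟩ := hzero
        rw [Finset.prod_eq_zero (Finset.mem_univ i) hi, mul_zero, add_zero]
        exact Finset.prod_nonneg fun i _ => hV0 i
      · push Not at hzero
        have h1 := one_sub_sum_abs_le_prod Finset.univ (fun i => V k π i / W π i)
          fun i => div_nonneg (hV0 i) (hW0 π i)
        have h2 : ∑ i, |V k π i / W π i - 1| = A k π := by
          simp only [A, hπ, if_true]
          refine Finset.sum_congr rfl fun i _ => ?_
          rw [← div_self (hzero i), ← sub_div, abs_div, abs_of_nonneg (hW0 π i)]
        rw [h2, Finset.prod_div_distrib, le_div_iff₀ (Finset.prod_pos fun i _ =>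
          (hW0 π i).lt_of_ne' (hzero i))] at h1
        linarith
    · rw [hν₀_ne π hπ]
      simp
  let G (k : Bits c) : Set (List (Fin N → Msg)) :=
    {π | genError (parityMeasure c b) (parityConcept b k) (P.output ρ π) ≤ 1 / 4}
  have hG : ∀ k, MeasurableSet (G k) := fun k => trivial
  -- The comparison is applied to the failure event, so that the error is integrated against `ν₀`.
  -- As `ν₀` is the same for all `k`, the errors can be summed over `k` pointwise.
  have hsucc : ∀ k, μ.real {s | genError (parityMeasure c b) (parityConcept b k) (P.outcome
        (fun i j => (s.1 i j, parityConcept b k (s.1 i j))) s.2 ρ) ≤ 1 / 4} ≤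
      ν₀.real (G k) + ∫ π, A k π ∂ν₀ := by
    intro k
    have h1 : μ.real {s | genError (parityMeasure c b) (parityConcept b k) (P.outcome
        (fun i j => (s.1 i j, parityConcept b k (s.1 i j))) s.2 ρ) ≤ 1 / 4} = (ν k).real (G k) :=
      (map_measureReal_apply (hT k) (hG k)).symm
    have h2 := measureReal_le_add_integral ν₀ (ν k) (A k) (hA0 k) _ (hA_le k) (hpoint k) (G k)ᶜ
    rw [probReal_compl_eq_one_sub (hG k), probReal_compl_eq_one_sub (hG k)] at h2
    rw [h1]
    linarith
  have hsumG : ∑ k, ν₀.real (G k) ≤ 4 := by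
    refine sum_measureReal_le_of_card_le ν₀ G hG 4 fun π => ?_
    have h1 := card_close_parities_le fun x => P.output ρ π (x, fun _ => false)
    refine le_trans (le_of_eq ?_) (Nat.cast_le (α := ℝ).2 h1)
    rw [Finset.card_eq_sum_ones, Finset.sum_filter]
    push_cast
    refine Finset.sum_congr rfl fun k _ => ?_
    rw [Set.indicator_apply]
    refine if_congr ?_ rfl rfl
    simp only [G, Set.mem_ofPred_eq, genError_parityMeasure]
  have hsumint : ∑ k, ∫ π, A k π ∂ν₀ ≤ N * √(2 ^ c) := by
    have hint : ∀ k, Integrable (A k) ν₀ := fun k => by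
      refine Integrable.of_bound (Measurable.of_discrete).aestronglyMeasurable (N * √(2 ^ c))
        (ae_of_all _ fun π => ?_)
      rw [Real.norm_of_nonneg (hA0 k π)]
      exact hA_le k π
    rw [← integral_finsetSum _ fun k _ => hint k]
    refine (integral_mono (integrable_finsetSum _ fun k _ => hint k) (integrable_const _)
      hsumA).trans ?_
    simp
  calc _ ≤ ∑ k, (ν₀.real (G k) + ∫ π, A k π ∂ν₀) := Finset.sum_le_sum fun k _ => hsucc k
    _ ≤ _ := by rw [Finset.sum_add_distrib]; exact add_le_add hsumG hsumint

/-- A private learner in the local model needs `2 ^ Ω(c)` agents, whatever its number of rounds. -/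
theorem local_lower_bound
    (P : LocalProtocol N ((Bits c × Bits b) × Bool) (Bits c × Bits b → Bool))
    (hP : P.IsPrivateLearner) :
    (3 / 4 : ℝ) * 2 ^ c ≤ 4 + N * √(2 ^ c) := by
  obtain ⟨hdp, hpac⟩ := hP
  let data := Measure.pi fun _ : Fin N => Measure.pi fun _ : Fin 1 => parityMeasure c b
  let law := Measure.pi fun i => (P.party i).law
  let E (k : Bits c) : Set ((Fin N → Fin 1 → Bits c × Bits b) ×
      ((i : Fin N) → (P.party i).Coins) × P.RefCoins) :=
    {s | genError (parityMeasure c b) (parityConcept b k)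
      (P.outcome (fun i j => (s.1 i j, parityConcept b k (s.1 i j))) s.2.1 s.2.2) ≤ 1 / 4}
  have hE : ∀ k, MeasurableSet (E k) := by
    intro k
    have hmap : Measurable fun s : (Fin N → Fin 1 → Bits c × Bits b) ×
        ((i : Fin N) → (P.party i).Coins) × P.RefCoins =>
        ((fun i j => (s.1 i j, parityConcept b k (s.1 i j)), s.2) : P.Sample) := by
      refine Measurable.prodMk ?_ measurable_snd
      exact (Measurable.of_discrete (f := fun (d : Fin N → Fin 1 → Bits c × Bits b) i j =>
        (d i j, parityConcept b k (d i j)))).comp measurable_fst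
    have hT : MeasurableSet {h | genError (parityMeasure c b) (parityConcept b k) h ≤ 1 / 4} :=
      (Set.toFinite _).measurableSet
    exact (P.measurable_outcome.comp hmap) hT
  -- The coins of the referee are moved outside, since transcripts have product form only when these
  -- are fixed.
  have hslice : ∀ k, (data.prod (law.prod P.refLaw)).real (E k) =
      ∫ ρ, (data.prod law).real {s | (s.1, s.2, ρ) ∈ E k} ∂P.refLaw := by
    intro k
    let φ : P.RefCoins × ((Fin N → Fin 1 → Bits c × Bits b) × ((i : Fin N) → (P.party i).Coins)) →
        (Fin N → Fin 1 → Bits c × Bits b) × ((i : Fin N) → (P.party i).Coins) × P.RefCoins :=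
      fun s => (s.2.1, s.2.2, s.1)
    have hφ : MeasurePreserving φ (P.refLaw.prod (data.prod law))
        (data.prod (law.prod P.refLaw)) :=
      (measurePreserving_prodAssoc data law P.refLaw).comp Measure.measurePreserving_swap
    rw [← hφ.measureReal_preimage (hE k).nullMeasurableSet,
      measureReal_prod_eq_integral _ _ (hφ.measurable (hE k))]
    rfl
  have hint : ∀ k, Integrable
      (fun ρ => (data.prod law).real {s | (s.1, s.2, ρ) ∈ E k}) P.refLaw := by
    intro k
    refine Integrable.of_bound (Measurable.aestronglyMeasurable ?_) 1 (ae_of_all _ fun ρ => ?_)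
    · have hmeas : MeasurableSet {s : P.RefCoins × ((Fin N → Fin 1 → Bits c × Bits b) ×
          ((i : Fin N) → (P.party i).Coins)) | (s.2.1, s.2.2, s.1) ∈ E k} :=
        (by fun_prop : Measurable fun s : P.RefCoins × ((Fin N → Fin 1 → Bits c × Bits b) ×
          ((i : Fin N) → (P.party i).Coins)) => (s.2.1, s.2.2, s.1)) (hE k)
      exact (measurable_measure_prodMk_left hmeas).ennreal_toReal
    · rw [Real.norm_of_nonneg measureReal_nonneg]
      exact measureReal_le_one
  calc (3 / 4 : ℝ) * 2 ^ c = ∑ _k : Bits c, (1 - 1 / 4 : ℝ) := by simp; ring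
    _ ≤ ∑ k, (data.prod (law.prod P.refLaw)).real (E k) :=
        Finset.sum_le_sum fun k _ =>
          hpac (parityConcept b k) ⟨k, _, rfl⟩ (parityMeasure c b) inferInstance
    _ = ∫ ρ, ∑ k, (data.prod law).real {s | (s.1, s.2, ρ) ∈ E k} ∂P.refLaw := by
        rw [integral_finsetSum _ fun k _ => hint k]
        exact Finset.sum_congr rfl fun k _ => hslice k
    _ ≤ ∫ _, (4 + N * √(2 ^ c)) ∂P.refLaw :=
        integral_mono (integrable_finsetSum _ fun k _ => hint k) (integrable_const _)
          fun ρ => sum_success_le P hdp ρ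
    _ = 4 + N * √(2 ^ c) := by simp

end LocalModel

/-! ## Concentration -/

/-- Hoeffding's inequality on a product space. -/
lemma hoeffding_pi {ι : Type*} [Fintype ι] {Ω : ι → Type*} [∀ i, MeasurableSpace (Ω i)]
    (μ : (i : ι) → Measure (Ω i)) [∀ i, IsProbabilityMeasure (μ i)] (s : Finset ι)
    (f : (i : ι) → Ω i → ℝ) (hf : ∀ i, Measurable (f i)) {B : ℝ}
    (hB : ∀ i ∈ s, ∀ ω, f i ω ∈ Set.Icc (-B) B) {δ : ℝ} (hδ : 0 ≤ δ) :
    (Measure.pi μ).real {ω | s.card * δ ≤ |∑ i ∈ s, f i (ω i) - ∑ i ∈ s, ∫ a, f i a ∂(μ i)|} ≤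
      2 * Real.exp (-(s.card * δ ^ 2 / (2 * B ^ 2))) := by
  let X (i : ι) (ω : (i : ι) → Ω i) : ℝ := f i (ω i) - ∫ a, f i a ∂(μ i)
  have hindep : ProbabilityTheory.iIndepFun X (Measure.pi μ) :=
    ProbabilityTheory.iIndepFun_pi (X := fun i a => f i a - ∫ a, f i a ∂(μ i))
      fun i => ((hf i).sub_const _).aemeasurable
  have hsub : ∀ i ∈ s, ProbabilityTheory.HasSubgaussianMGF (X i) ((‖B - -B‖₊ / 2) ^ 2)
      (Measure.pi μ) := by
    intro i hi
    have h1 := ProbabilityTheory.hasSubgaussianMGF_of_mem_Icc (μ := Measure.pi μ)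
      (X := fun ω => f i (ω i)) ((hf i).comp (measurable_pi_apply i)).aemeasurable
      (ae_of_all _ fun ω => hB i hi (ω i))
    have h2 : ∫ ω, f i (ω i) ∂(Measure.pi μ) = ∫ a, f i a ∂(μ i) := by
      conv_rhs => rw [← (measurePreserving_eval μ i).map_eq]
      rw [integral_map (measurable_pi_apply i).aemeasurable (hf i).aestronglyMeasurable]
    rw [h2] at h1
    exact h1
  have hε : (0 : ℝ) ≤ s.card * δ := by positivity
  have hconst : ((∑ _i ∈ s, (‖B - -B‖₊ / 2) ^ 2 : NNReal) : ℝ) = s.card * B ^ 2 := by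
    simp only [Finset.sum_const, nsmul_eq_mul]
    push_cast
    rw [sub_neg_eq_add, ← two_mul, norm_mul, Real.norm_two, mul_div_cancel_left₀ _ (by norm_num),
      Real.norm_eq_abs, sq_abs]
  have hexp : -(s.card * δ) ^ 2 / (2 * (s.card * B ^ 2)) = -(s.card * δ ^ 2 / (2 * B ^ 2)) := by
    rcases Nat.eq_zero_or_pos s.card with h | h
    · simp [h]
    · have : (s.card : ℝ) ≠ 0 := by positivity
      -- For `B = 0` both exponents are `0` by the convention on division, and the resulting bound
      -- `2` is trivial.
      rcases eq_or_ne B 0 with rfl | hB0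
      · simp
      · field_simp
  have hpos := ProbabilityTheory.HasSubgaussianMGF.measure_sum_ge_le_of_iIndepFun hindep hsub hε
  have hneg := ProbabilityTheory.HasSubgaussianMGF.measure_sum_ge_le_of_iIndepFun
    (X := fun i ω => -X i ω) (hindep.comp (fun _ x => -x) fun _ => measurable_neg)
    (fun i hi => (hsub i hi).neg) hε
  rw [hconst, hexp] at hpos hneg
  rw [two_mul]
  refine (measureReal_mono ?_).trans ((measureReal_union_le _ _).trans (add_le_add hpos hneg))
  intro ω hω
  simp only [Set.mem_ofPred_eq, Set.mem_union, X] at hω ⊢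
  rw [Finset.sum_neg_distrib, Finset.sum_sub_distrib]
  exact le_abs.1 hω

/-- Hoeffding's inequality for the coordinates in `Fin n` of a product over `Option (Fin n)`. -/
lemma hoeffding_pi_some {n : ℕ} {Ω : Option (Fin n) → Type*} [∀ i, MeasurableSpace (Ω i)]
    (μ : (i : Option (Fin n)) → Measure (Ω i)) [∀ i, IsProbabilityMeasure (μ i)]
    (f : (i : Option (Fin n)) → Ω i → ℝ) (hf : ∀ i, Measurable (f i)) {B : ℝ}
    (hB : ∀ (i : Fin n) ω, f (some i) ω ∈ Set.Icc (-B) B) {δ : ℝ} (hδ : 0 ≤ δ) :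
    (Measure.pi μ).real {ω | n * δ ≤ |∑ i : Fin n, f (some i) (ω (some i)) -
        ∑ i : Fin n, ∫ a, f (some i) a ∂(μ (some i))|} ≤
      2 * Real.exp (-(n * δ ^ 2 / (2 * B ^ 2))) := by
  have h := hoeffding_pi μ (Finset.univ.map Function.Embedding.some) f hf (B := B)
    (fun i hi ω => by
      obtain ⟨j, -, rfl⟩ := Finset.mem_map.1 hi
      exact hB j ω) hδ
  simp only [Finset.sum_map, Finset.card_map, Finset.card_univ, Fintype.card_fin] at h
  exact h

/-- Quantile brackets. -/
lemma exists_brackets {T : Type*} [Fintype T] [Nonempty T] (v : T → ℕ) (F : T → ℝ)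
    (h0 : ∀ t, 0 ≤ F t) (h1 : ∀ t, F t ≤ 1) (J : ℕ) (hJ : 0 < J) :
    ∃ lo hi : Fin (J + 1) → T, (∀ i, F (hi i) ≤ F (lo i) + 1 / J) ∧
      ∀ t, ∃ i, v (lo i) ≤ v t ∧ v t ≤ v (hi i) := by
  have hJ' : (0 : ℝ) < J := by exact_mod_cast hJ
  -- Bracket `i` spans the `t` with `F t` in `[i / J, (i + 1) / J)`; the index `J` serves `F t = 1`.
  -- An empty class gets a one-point bracket.
  have key : ∀ i : Fin (J + 1), ∃ p : T × T, F p.2 ≤ F p.1 + 1 / J ∧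
      ∀ t, ⌊F t * J⌋₊ = i → v p.1 ≤ v t ∧ v t ≤ v p.2 := by
    intro i
    by_cases hne : (Finset.univ.filter fun t => ⌊F t * J⌋₊ = (i : ℕ)).Nonempty
    · obtain ⟨l, hl, hl'⟩ := Finset.exists_min_image _ v hne
      obtain ⟨u, hu, hu'⟩ := Finset.exists_max_image _ v hne
      simp only [Finset.mem_filter, Finset.mem_univ, true_and] at hl hl' hu hu'
      refine ⟨(l, u), ?_, fun t ht => ⟨hl' t ht, hu' t ht⟩⟩
      have h2 := Nat.lt_floor_add_one (F u * J)
      have h3 := Nat.floor_le (mul_nonneg (h0 l) hJ'.le)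
      rw [hu] at h2
      rw [hl] at h3
      have h4 : F u * J ≤ (F l + 1 / J) * J := by
        rw [add_mul, one_div_mul_cancel hJ'.ne']
        linarith
      exact le_of_mul_le_mul_right h4 hJ'
    · obtain ⟨t₀⟩ := ‹Nonempty T›
      refine ⟨(t₀, t₀), by simp, fun t ht => absurd ⟨t, ?_⟩ hne⟩
      simpa using ht
  choose p hp1 hp2 using key
  refine ⟨fun i => (p i).1, fun i => (p i).2, hp1, fun t => ?_⟩
  have hlt : ⌊F t * J⌋₊ < J + 1 := by
    rw [Nat.lt_succ_iff]
    refine Nat.floor_le_of_le ?_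
    nlinarith [h1 t]
  exact ⟨⟨_, hlt⟩, hp2 ⟨_, hlt⟩ t rfl⟩

/-! ## Parties given by weights -/

/-- The distribution with the given point masses. -/
noncomputable def weightPMF {O : Type*} [Fintype O] (w : O → ℝ) (h0 : ∀ o, 0 ≤ w o)
    (h1 : ∑ o, w o = 1) : PMF O :=
  PMF.ofFintype (fun o => ENNReal.ofReal (w o)) (by
    rw [← ENNReal.ofReal_sum_of_nonneg fun o _ => h0 o, h1, ENNReal.ofReal_one])

lemma integral_weightPMF {O : Type*} [Fintype O] [MeasurableSpace O] [MeasurableSingletonClass O]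
    {w : O → ℝ} (h0 : ∀ o, 0 ≤ w o) (h1 : ∑ o, w o = 1) (g : O → ℝ) :
    ∫ o, g o ∂(weightPMF w h0 h1).toMeasure = ∑ o, w o * g o := by
  rw [PMF.integral_eq_sum]
  simp [weightPMF, ENNReal.toReal_ofReal (h0 _)]

lemma measureReal_weightPMF {O : Type*} [Fintype O] [MeasurableSpace O]
    [MeasurableSingletonClass O] {w : O → ℝ} (h0 : ∀ o, 0 ≤ w o) (h1 : ∑ o, w o = 1)
    (E : Set O) [DecidablePred (· ∈ E)] :
    (weightPMF w h0 h1).toMeasure.real E = ∑ o with o ∈ E, w o := by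
  have hE : MeasurableSet E := E.toFinite.measurableSet
  have := integral_weightPMF h0 h1 (E.indicator fun _ => (1 : ℝ))
  rw [integral_indicator_const _ hE] at this
  simp only [smul_eq_mul, mul_one] at this
  rw [this, Finset.sum_filter]
  refine Finset.sum_congr rfl fun o _ => ?_
  by_cases ho : o ∈ E <;> simp [ho]

/-- A randomized map from inputs to messages from a finite set, given by its point masses. -/
structure Mechanism (I O : Type) [Fintype O] where
  weight : I → O → ℝ
  weight_nonneg : ∀ x o, 0 ≤ weight x o
  weight_sum : ∀ x, ∑ o, weight x o = 1

namespace Mechanism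

variable {ℓ : ℕ} {I Z O : Type} [Fintype O]

/-- The distribution of the messages of a mechanism. -/
noncomputable def dist (K : Mechanism I O) [MeasurableSpace O] (x : I) : Measure O :=
  (weightPMF (K.weight x) (K.weight_nonneg x) (K.weight_sum x)).toMeasure

instance (K : Mechanism I O) [MeasurableSpace O] (x : I) : IsProbabilityMeasure (K.dist x) :=
  PMF.toMeasure.isProbabilityMeasure _

/-- The codes of the elements of a finite type. -/
noncomputable def code (o : O) : Msg := Fintype.equivFin O o

lemma code_injective : Function.Injective (code : O → Msg) := fun _ _ h =>
  (Fintype.equivFin O).injective (Fin.ext h)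

variable [MeasurableSpace O] [MeasurableSingletonClass O] [Fintype Z]

/-- The party that sends a message of the mechanism `K`; its coins are tables with a message for
every input. -/
noncomputable def toParty (K : Mechanism (Fin ℓ → Z) O) : Party ℓ Z where
  Coins := (Fin ℓ → Z) → O
  law := Measure.pi fun x => K.dist x
  next x ω _ := code (ω x)
  measurable_next x _ := (Measurable.of_discrete (f := code)).comp (measurable_pi_apply x)

lemma measurePreserving_toParty (K : Mechanism (Fin ℓ → Z) O) (x : Fin ℓ → Z) :
    MeasurePreserving (fun ω : K.toParty.Coins => (ω : (Fin ℓ → Z) → O) x) K.toParty.law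
      (K.dist x) :=
  measurePreserving_eval (fun x => K.dist x) x

lemma dist_le_exp_mul (K : Mechanism I O) {ε : ℝ} {x x' : I}
    (h : ∀ o, K.weight x o ≤ Real.exp ε * K.weight x' o) (E : Set O) :
    K.dist x E ≤ ENNReal.ofReal (Real.exp ε) * K.dist x' E := by
  classical
  have key : (K.dist x).real E ≤ Real.exp ε * (K.dist x').real E := by
    unfold dist
    rw [measureReal_weightPMF, measureReal_weightPMF, Finset.mul_sum]
    exact Finset.sum_le_sum fun o _ => h o
  rw [← ofReal_measureReal, ← ofReal_measureReal, ← ENNReal.ofReal_mul (Real.exp_pos _).le]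
  exact ENNReal.ofReal_le_ofReal key

/-- The party ignores the query, so in one round the adversary only post-processes a single message.
For fixed coins of the adversary its event is a set of messages. -/
lemma advProb_toParty_le (K : Mechanism (Fin ℓ → Z) O) {ε : ℝ}
    (h : ∀ x x', Neighboring x x' → ∀ o, K.weight x o ≤ Real.exp ε * K.weight x' o)
    (A : Adversary) {x x' : Fin ℓ → Z} (hx : Neighboring x x') {T : Set A.Out}
    (hT : MeasurableSet T) :
    K.toParty.advProb 1 A x T ≤ Real.exp ε * K.toParty.advProb 1 A x' T := by
  have hmeas : MeasurableSet {p : O × A.Coins | A.output p.2 [code p.1] ∈ T} := by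
    have : Measurable fun p : O × A.Coins => A.output p.2 [code p.1] :=
      measurable_from_prod_countable_right fun o => A.measurable_output [code o]
    exact this hT
  have key : ∀ x, K.toParty.advProb 1 A x T =
      ((K.dist x).prod A.law).real {p | A.output p.2 [code p.1] ∈ T} := by
    intro x
    have hpres := (K.measurePreserving_toParty x).prod (MeasurePreserving.id A.law)
    rw [← hpres.measureReal_preimage hmeas.nullMeasurableSet]
    rfl
  rw [key, key, measureReal_def, measureReal_def,
    ← ENNReal.toReal_ofReal (Real.exp_pos ε).le, ← ENNReal.toReal_mul]
  refine ENNReal.toReal_mono (ENNReal.mul_ne_top ENNReal.ofReal_ne_top (measure_ne_top _ _)) ?_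
  rw [Measure.prod_apply_symm hmeas, Measure.prod_apply_symm hmeas,
    ← lintegral_const_mul' _ _ ENNReal.ofReal_ne_top]
  exact lintegral_mono fun a => K.dist_le_exp_mul (h x x' hx) _

end Mechanism

/-! ## The exponential mechanism -/

/-- The exponential mechanism for losses of sensitivity `2` and privacy parameter `1/4`. -/
noncomputable def expMechanism {I O : Type} [Fintype O] [Nonempty O] (L : I → O → ℝ) :
    Mechanism I O where
  weight x o := Real.exp (-L x o / 16) / ∑ o', Real.exp (-L x o' / 16)
  weight_nonneg x o := by positivity
  weight_sum x := by
    rw [← Finset.sum_div, div_self]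
    exact (Finset.sum_pos (fun o _ => Real.exp_pos _) Finset.univ_nonempty).ne'

/-- The numerator and the normalizing sum each contribute at most a factor `exp (2 / 16)`. -/
lemma expMechanism_weight_le {I O : Type} [Fintype O] [Nonempty O] {L : I → O → ℝ} {x x' : I}
    (h : ∀ o, |L x o - L x' o| ≤ 2) (o : O) :
    (expMechanism L).weight x o ≤ Real.exp (1 / 4) * (expMechanism L).weight x' o := by
  have hpos : ∀ x, 0 < ∑ o', Real.exp (-L x o' / 16) := fun x =>
    Finset.sum_pos (fun o _ => Real.exp_pos _) Finset.univ_nonempty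
  have h1 : Real.exp (-L x o / 16) ≤ Real.exp (1 / 8) * Real.exp (-L x' o / 16) := by
    rw [← Real.exp_add]
    refine Real.exp_le_exp.2 ?_
    have := (abs_le.1 (h o)).1
    linarith
  have h2 : ∑ o', Real.exp (-L x' o' / 16) ≤
      Real.exp (1 / 8) * ∑ o', Real.exp (-L x o' / 16) := by
    rw [Finset.mul_sum]
    refine Finset.sum_le_sum fun o' _ => ?_
    rw [← Real.exp_add]
    refine Real.exp_le_exp.2 ?_
    have := (abs_le.1 (h o')).2
    linarith
  have h3 : Real.exp (1 / 4) = Real.exp (1 / 8) * Real.exp (1 / 8) := by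
    rw [← Real.exp_add]; norm_num
  simp only [expMechanism]
  rw [h3, mul_div_assoc', div_le_div_iff₀ (hpos x) (hpos x')]
  calc Real.exp (-L x o / 16) * ∑ o', Real.exp (-L x' o' / 16)
      ≤ (Real.exp (1 / 8) * Real.exp (-L x' o / 16)) *
        (Real.exp (1 / 8) * ∑ o', Real.exp (-L x o' / 16)) :=
        mul_le_mul h1 h2 (hpos x').le (by positivity)
    _ = _ := by ring

/-- The normalizing sum is at least the term of `o₀`, so each bad output has mass at most `exp (-s /
16)`. -/
lemma expMechanism_utility {I O : Type} [Fintype O] [Nonempty O] [MeasurableSpace O]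
    [MeasurableSingletonClass O] (L : I → O → ℝ) (x : I) (o₀ : O) {a s : ℝ}
    (ho₀ : L x o₀ ≤ a) :
    ((expMechanism L).dist x).real {o | a + s < L x o} ≤ Fintype.card O * Real.exp (-s / 16) := by
  classical
  unfold Mechanism.dist
  rw [measureReal_weightPMF]
  calc ∑ o with o ∈ {o | a + s < L x o}, (expMechanism L).weight x o
      ≤ ∑ o with o ∈ {o | a + s < L x o}, Real.exp (-s / 16) := by
        refine Finset.sum_le_sum fun o ho => ?_
        have ho' : a + s < L x o := by simpa using ho
        have h1 : Real.exp (-L x o₀ / 16) ≤ ∑ o', Real.exp (-L x o' / 16) :=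
          Finset.single_le_sum (f := fun o' => Real.exp (-L x o' / 16))
            (fun o' _ => (Real.exp_pos _).le) (Finset.mem_univ o₀)
        simp only [expMechanism]
        rw [div_le_iff₀ ((Real.exp_pos _).trans_le h1)]
        refine le_trans ?_ (mul_le_mul_of_nonneg_left h1 (Real.exp_pos _).le)
        rw [← Real.exp_add]
        refine Real.exp_le_exp.2 ?_
        linarith
    _ ≤ ∑ _o : O, Real.exp (-s / 16) :=
        Finset.sum_le_sum_of_subset_of_nonneg (Finset.subset_univ _)
          fun _ _ _ => (Real.exp_pos _).le
    _ = _ := by simp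

/-! ## The curator -/

section Curator

variable {b c m : ℕ}

/-- The number of examples on which the hypothesis with parity `k` and threshold `t` errs. -/
def errCount (S : Fin m → (Bits c × Bits b) × Bool) (k : Bits c) (t : Bits b) : ℝ :=
  ∑ j, if xor (par k (S j).1.1) (thr t (S j).1.2) ≠ (S j).2 then 1 else 0

/-- The number of examples below the threshold `t`. -/
def belowCount (S : Fin m → (Bits c × Bits b) × Bool) (t : Bits b) : ℝ :=
  ∑ j, if Bits.val (S j).1.2 < Bits.val t then 1 else 0

/-- The loss of a parity and a quantile: the best trade-off, over all thresholds, between the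
number of errors and the distance to the quantile. -/
noncomputable def curatorLoss (S : Fin m → (Bits c × Bits b) × Bool) (o : Bits c × Fin 129) : ℝ :=
  Finset.univ.inf' Finset.univ_nonempty fun t : Bits b =>
    errCount S o.1 t + |belowCount S t - (o.2 : ℕ) / 128 * m|

lemma abs_sum_sub_le_of_neighboring {Z : Type} {S S' : Fin m → Z} (h : Neighboring S S')
    (g : Z → ℝ) (h0 : ∀ z, 0 ≤ g z) (h1 : ∀ z, g z ≤ 1) :
    |∑ j, g (S j) - ∑ j, g (S' j)| ≤ 1 := by
  obtain ⟨i, hi⟩ := h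
  rw [← Finset.sum_sub_distrib, Finset.sum_eq_single i]
  · have := h0 (S i); have := h1 (S i); have := h0 (S' i); have := h1 (S' i)
    rw [abs_le]
    constructor <;> linarith
  · intro j _ hj
    rw [hi j hj, sub_self]
  · simp

lemma Neighboring.symm {Z : Type} {S S' : Fin m → Z} (h : Neighboring S S') :
    Neighboring S' S := by
  obtain ⟨i, hi⟩ := h
  exact ⟨i, fun j hj => (hi j hj).symm⟩

/-- The minimizer for `S'` is a candidate for `S`, and each of the two counts changes by at most
one. -/
lemma curatorLoss_le_add_two {S S' : Fin m → (Bits c × Bits b) × Bool} (h : Neighboring S S')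
    (o : Bits c × Fin 129) : curatorLoss S o ≤ curatorLoss S' o + 2 := by
  obtain ⟨t, -, ht⟩ := Finset.exists_mem_eq_inf' (Finset.univ_nonempty (α := Bits b))
    fun t : Bits b => errCount S' o.1 t + |belowCount S' t - (o.2 : ℕ) / 128 * m|
  have h1 : curatorLoss S o ≤ errCount S o.1 t + |belowCount S t - (o.2 : ℕ) / 128 * m| :=
    Finset.inf'_le _ (Finset.mem_univ t)
  have h2 := abs_sum_sub_le_of_neighboring h
    (fun z => if xor (par o.1 z.1.1) (thr t z.1.2) ≠ z.2 then 1 else 0)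
    (fun z => by split_ifs <;> norm_num) (fun z => by split_ifs <;> norm_num)
  have h3 := abs_sum_sub_le_of_neighboring h
    (fun z => if Bits.val z.1.2 < Bits.val t then 1 else 0)
    (fun z => by split_ifs <;> norm_num) (fun z => by split_ifs <;> norm_num)
  have h4 := abs_sub_abs_le_abs_sub (belowCount S t - (o.2 : ℕ) / 128 * m)
    (belowCount S' t - (o.2 : ℕ) / 128 * m)
  rw [sub_sub_sub_cancel_right] at h4
  have h5 := (abs_le.1 h2).2
  change errCount S o.1 t - errCount S' o.1 t ≤ 1 at h5
  change |belowCount S t - belowCount S' t| ≤ 1 at h3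
  have h6 : curatorLoss S' o = errCount S' o.1 t + |belowCount S' t - (o.2 : ℕ) / 128 * m| := ht
  linarith

lemma abs_curatorLoss_sub_le {S S' : Fin m → (Bits c × Bits b) × Bool} (h : Neighboring S S')
    (o : Bits c × Fin 129) : |curatorLoss S o - curatorLoss S' o| ≤ 2 := by
  have h1 := curatorLoss_le_add_two h o
  have h2 := curatorLoss_le_add_two h.symm o
  rw [abs_le]
  constructor <;> linarith

end Curator

/-! ## The local agents -/

section Agent

variable {b c : ℕ}

/-- The initial segment of `y` of length `j + 1`, padded with zeros. -/
def truncThrough (j : Fin b) (y : Bits b) : Bits b := fun i => if i ≤ j then y i else false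

/-- The initial segment of `t` of length `j`, padded with zeros. -/
def truncBefore (j : Fin b) (t : Bits b) : Bits b := fun i => if i < j then t i else false

/-- The padding of `truncBefore` supplies the zero that `y` must have at level `j`. -/
lemma truncThrough_eq_iff (j : Fin b) (y t : Bits b) :
    truncThrough j y = truncBefore j t ↔ y j = false ∧ ∀ i < j, y i = t i := by
  constructor
  · intro h
    refine ⟨by simpa [truncThrough, truncBefore] using congrFun h j, fun i hi => ?_⟩
    simpa [truncThrough, truncBefore, hi, hi.le] using congrFun h i
  · rintro ⟨h1, h2⟩
    funext i
    simp only [truncThrough, truncBefore]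
    rcases lt_trichotomy i j with hi | rfl | hi
    · simp [hi, hi.le, h2 i hi]
    · simp [h1]
    · simp [hi.not_ge, hi.le.not_gt]

/-- Every `y` below `t` leaves the path to `t` at exactly one level. -/
lemma sum_trunc_eq (y t : Bits b) :
    ∑ j, (if t j = true ∧ truncThrough j y = truncBefore j t then (1 : ℝ) else 0) =
      if Bits.val y < Bits.val t then 1 else 0 := by
  simp only [truncThrough_eq_iff]
  split_ifs with h
  · obtain ⟨j, hj1, hj2, hj3⟩ := (Bits.val_lt_val_iff y t).1 h
    rw [Finset.sum_eq_single j]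
    · simp only [hj1, hj2, true_and]
      exact if_pos hj3
    · intro i _ hij
      refine if_neg ?_
      rintro ⟨h1, h2, h3⟩
      rcases lt_or_gt_of_ne hij with hlt | hgt
      · have := hj3 i hlt
        simp [h1, h2] at this
      · have := h3 j hgt
        simp [hj1, hj2] at this
    · simp
  · refine Finset.sum_eq_zero fun j _ => if_neg fun hj => h ?_
    exact (Bits.val_lt_val_iff y t).2 ⟨j, hj⟩

/-- For `u ≠ v`, flipping `σ u` negates every summand. -/
lemma sum_sgn_apply_mul {α : Type*} [Fintype α] [DecidableEq α] (u v : α) :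
    ∑ σ : α → Bool, sgn (σ u) * sgn (σ v) =
      if u = v then (Fintype.card (α → Bool) : ℝ) else 0 := by
  split_ifs with h
  · subst h
    simp [sgn_mul_self]
  · have hinv : Function.Involutive fun σ : α → Bool => Function.update σ u (!σ u) := by
      intro σ
      simp
    have h1 := Equiv.sum_comp hinv.toPerm fun σ : α → Bool => sgn (σ u) * sgn (σ v)
    have h2 : ∀ σ : α → Bool, sgn ((hinv.toPerm) σ u) * sgn ((hinv.toPerm) σ v) =
        -(sgn (σ u) * sgn (σ v)) := by
      intro σ
      simp only [Function.Involutive.coe_toPerm, Function.update_self,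
        Function.update_of_ne (Ne.symm h)]
      cases σ u <;> cases σ v <;> simp [sgn]
    simp only [h2, Finset.sum_neg_distrib] at h1
    linarith

/-- The messages of the agents: a level, a sign for every initial segment, and a noisy sign. -/
abbrev AgentMsg (b : ℕ) : Type := Fin b × (Bits b → Bool) × Bool

lemma sum_agentMsg (g : AgentMsg b → ℝ) : ∑ o, g o = ∑ j, ∑ σ, ∑ a, g (j, σ, a) := by
  rw [Fintype.sum_prod_type]
  exact Finset.sum_congr rfl fun j _ => by rw [Fintype.sum_prod_type]

/-- The agents pick a random level and random signs, and send the sign of their own initial segment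
with randomized response. -/
noncomputable def agentMechanism (b c : ℕ) [NeZero b] :
    Mechanism (Fin 1 → (Bits c × Bits b) × Bool) (AgentMsg b) where
  weight x o := (if o.2.2 = o.2.1 (truncThrough o.1 (x 0).1.2) then 11 / 20 else 9 / 20) /
    (b * Fintype.card (Bits b → Bool))
  weight_nonneg x o := by split_ifs <;> positivity
  weight_sum x := by
    have hb : (b : ℝ) ≠ 0 := by exact_mod_cast NeZero.ne b
    have hK : (Fintype.card (Bits b → Bool) : ℝ) ≠ 0 := by exact_mod_cast Fintype.card_ne_zero
    rw [sum_agentMsg]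
    have h1 : ∀ (j : Fin b) (σ : Bits b → Bool),
        ∑ a : Bool, (if a = σ (truncThrough j (x 0).1.2) then (11 / 20 : ℝ) else 9 / 20) /
          (b * Fintype.card (Bits b → Bool)) = 1 / (b * Fintype.card (Bits b → Bool)) := by
      intro j σ
      rw [← Finset.sum_div, Fintype.sum_bool]
      congr 1
      cases σ (truncThrough j (x 0).1.2) <;> norm_num
    simp only [h1, Finset.sum_const, Finset.card_univ, nsmul_eq_mul, Fintype.card_fin]
    field_simp

/-- Level and signs are independent of the input, and the two response weights have ratio `11 / 9 ≤
5 / 4`. -/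
lemma agentMechanism_weight_le [NeZero b] (x x' : Fin 1 → (Bits c × Bits b) × Bool)
    (o : AgentMsg b) :
    (agentMechanism b c).weight x o ≤ Real.exp (1 / 4) * (agentMechanism b c).weight x' o := by
  have h1 : (5 / 4 : ℝ) ≤ Real.exp (1 / 4) := by
    have := Real.add_one_le_exp (1 / 4 : ℝ)
    linarith
  simp only [agentMechanism]
  rw [← mul_div_assoc]
  refine div_le_div_of_nonneg_right ?_ (by positivity)
  split_ifs <;> linarith

/-- The estimator of the event that the example of an agent is below the threshold `t`. -/
noncomputable def belowEstimator (t : Bits b) (o : AgentMsg b) : ℝ :=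
  if t o.1 = true then 10 * b * (sgn o.2.2 * sgn (o.2.1 (truncBefore o.1 t))) else 0

lemma belowEstimator_mem_Icc (t : Bits b) (o : AgentMsg b) :
    belowEstimator t o ∈ Set.Icc (-(10 * b : ℝ)) (10 * b) := by
  rw [Set.mem_Icc, ← abs_le]
  unfold belowEstimator
  split_ifs
  · rw [abs_mul, abs_mul (sgn _), abs_sgn, abs_sgn, abs_of_nonneg (by positivity)]
    simp
  · simp

/-- The factor `b` undoes the choice of the level and `10` the bias `11 / 20 - 9 / 20`. Averaging
over the signs tests equality of two initial segments; exactly one level with `t j = true` passes if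
the example is below `t`, and none otherwise. -/
lemma integral_belowEstimator [NeZero b] (t : Bits b) (x : Fin 1 → (Bits c × Bits b) × Bool) :
    ∫ o, belowEstimator t o ∂((agentMechanism b c).dist x) =
      if Bits.val (x 0).1.2 < Bits.val t then 1 else 0 := by
  have hb : (b : ℝ) ≠ 0 := by exact_mod_cast NeZero.ne b
  have hK : (Fintype.card (Bits b → Bool) : ℝ) ≠ 0 := by exact_mod_cast Fintype.card_ne_zero
  unfold Mechanism.dist
  rw [integral_weightPMF, sum_agentMsg, ← sum_trunc_eq]
  refine Finset.sum_congr rfl fun j _ => ?_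
  by_cases hj : t j = true
  · have h1 : ∀ σ : Bits b → Bool, ∑ a : Bool, (agentMechanism b c).weight x (j, σ, a) *
        belowEstimator t (j, σ, a) = sgn (σ (truncThrough j (x 0).1.2)) *
          sgn (σ (truncBefore j t)) / Fintype.card (Bits b → Bool) := by
      intro σ
      simp only [agentMechanism, belowEstimator, hj, if_true, Fintype.sum_bool]
      field_simp
      cases σ (truncThrough j (x 0).1.2) <;> norm_num [sgn]
    simp only [h1, hj, true_and]
    rw [← Finset.sum_div, sum_sgn_apply_mul]
    split_ifs
    · exact div_self hK
    · simp
  · simp [belowEstimator, hj]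

end Agent

/-! ## The learner in the hybrid model -/

section Referee

variable {b c m n : ℕ}

/-- The threshold whose estimated quantile is closest to `p / 128`. -/
noncomputable def quantileThreshold (p : ℕ) (msgs : Fin n → AgentMsg b) : Bits b :=
  (Finset.exists_min_image Finset.univ
    (fun t : Bits b => |(∑ i, belowEstimator t (msgs i)) / n - (p : ℝ) / 128|)
    Finset.univ_nonempty).choose

lemma quantileThreshold_le (p : ℕ) (msgs : Fin n → AgentMsg b) (t : Bits b) :
    |(∑ i, belowEstimator (quantileThreshold p msgs) (msgs i)) / n - (p : ℝ) / 128| ≤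
      |(∑ i, belowEstimator t (msgs i)) / n - (p : ℝ) / 128| :=
  (Finset.exists_min_image Finset.univ
    (fun t : Bits b => |(∑ i, belowEstimator t (msgs i)) / n - (p : ℝ) / 128|)
    Finset.univ_nonempty).choose_spec.2 t (Finset.mem_univ t)

/-- The concept with parity `k` and threshold `t`. -/
def concept (k : Bits c) (t : Bits b) : Bits c × Bits b → Bool := fun z =>
  xor (par k z.1) (thr t z.2)

/-- The hypothesis of the referee: the parity of the curator and the threshold at its quantile. -/
noncomputable def hypothesis (o : Bits c × Fin 129) (msgs : Fin n → AgentMsg b) :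
    Bits c × Bits b → Bool :=
  concept o.1 (quantileThreshold o.2 msgs)

/-- The probability of an example below the threshold `t`. -/
noncomputable def belowProb (D : Measure (Bits c × Bits b)) (t : Bits b) : ℝ :=
  D.real {z | Bits.val z.2 < Bits.val t}

lemma measureReal_between (D : Measure (Bits c × Bits b)) [IsProbabilityMeasure D] {s t : Bits b}
    (h : Bits.val s ≤ Bits.val t) :
    D.real {z | Bits.val s ≤ Bits.val z.2 ∧ Bits.val z.2 < Bits.val t} =
      belowProb D t - belowProb D s := by
  have hset : {z : Bits c × Bits b | Bits.val s ≤ Bits.val z.2 ∧ Bits.val z.2 < Bits.val t} =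
      {z | Bits.val z.2 < Bits.val t} \ {z | Bits.val z.2 < Bits.val s} := by
    ext z
    simp only [Set.mem_ofPred_eq, Set.mem_sdiff, not_lt]
    exact and_comm
  have hsub : {z : Bits c × Bits b | Bits.val z.2 < Bits.val s} ⊆
      {z | Bits.val z.2 < Bits.val t} := fun z hz => lt_of_lt_of_le hz h
  rw [hset, measureReal_sdiff hsub (Set.toFinite _).measurableSet]
  rfl

lemma setOf_concept_ne_subset (f : Bits c × Bits b → Bool) (k : Bits c) {s t : Bits b}
    (h : Bits.val s ≤ Bits.val t) :
    {z | concept k s z ≠ f z} ⊆ {z | concept k t z ≠ f z} ∪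
      {z | Bits.val s ≤ Bits.val z.2 ∧ Bits.val z.2 < Bits.val t} ∧
    {z | concept k t z ≠ f z} ⊆ {z | concept k s z ≠ f z} ∪
      {z | Bits.val s ≤ Bits.val z.2 ∧ Bits.val z.2 < Bits.val t} := by
  have key : ∀ z : Bits c × Bits b, ¬ (Bits.val s ≤ Bits.val z.2 ∧ Bits.val z.2 < Bits.val t) →
      concept k s z = concept k t z := by
    intro z hz
    have : (Bits.val s ≤ Bits.val z.2) ↔ (Bits.val t ≤ Bits.val z.2) := by omega
    simp only [concept, thr, this]
  constructor <;> intro z hz <;> by_cases hb : Bits.val s ≤ Bits.val z.2 ∧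
      Bits.val z.2 < Bits.val t
  · exact Or.inr hb
  · refine Or.inl ?_
    simpa only [Set.mem_ofPred_eq, key z hb] using hz
  · exact Or.inr hb
  · refine Or.inl ?_
    simpa only [Set.mem_ofPred_eq, key z hb] using hz

/-- Concepts with the same parity differ only between their thresholds. Hence a threshold matters
only through its quantile, and the curator need not reveal more. -/
lemma genError_concept_le (D : Measure (Bits c × Bits b)) [IsProbabilityMeasure D]
    (f : Bits c × Bits b → Bool) (k : Bits c) (s t : Bits b) :
    genError D f (concept k s) ≤ genError D f (concept k t) + |belowProb D s - belowProb D t| := by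
  unfold genError
  rcases le_total (Bits.val s) (Bits.val t) with h | h
  · refine (measureReal_mono (setOf_concept_ne_subset f k h).1).trans
      ((measureReal_union_le _ _).trans ?_)
    rw [measureReal_between D h, abs_sub_comm]
    gcongr
    exact le_abs_self _
  · refine (measureReal_mono (setOf_concept_ne_subset f k h).2).trans
      ((measureReal_union_le _ _).trans ?_)
    rw [measureReal_between D h]
    gcongr
    exact le_abs_self _

open Classical in
/-- The number of points of the sample in the set `E`. -/
noncomputable def countIn {X : Type*} (S : Fin m → X) (E : Set X) : ℝ :=
  ∑ j, if S j ∈ E then 1 else 0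

lemma countIn_le_add {X : Type*} (S : Fin m → X) {E E₁ E₂ : Set X} (h : E ⊆ E₁ ∪ E₂) :
    countIn S E ≤ countIn S E₁ + countIn S E₂ := by
  unfold countIn
  rw [← Finset.sum_add_distrib]
  refine Finset.sum_le_sum fun j _ => ?_
  have := @h (S j)
  by_cases h0 : S j ∈ E
  · rcases this h0 with h1 | h1 <;> simp only [h0, h1, if_true] <;> split_ifs <;> norm_num
  · simp only [h0, if_false]
    split_ifs <;> norm_num

lemma countIn_mono {X : Type*} (S : Fin m → X) {E E' : Set X} (h : E ⊆ E') :
    countIn S E ≤ countIn S E' := by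
  unfold countIn
  refine Finset.sum_le_sum fun j _ => ?_
  have := @h (S j)
  by_cases h0 : S j ∈ E
  · simp [h0, this h0]
  · simp only [h0, if_false]
    split_ifs <;> norm_num

/-- The sets on which the sample of the curator has to be representative. -/
def testSet (f : Bits c × Bits b → Bool) (lo hi : Fin 129 → Bits b) :
    (Bits c × Fin 129) ⊕ Fin 129 ⊕ Fin 129 → Set (Bits c × Bits b)
  | .inl a => {z | concept a.1 (lo a.2) z ≠ f z}
  | .inr (.inl i) => {z | Bits.val z.2 < Bits.val (lo i)}
  | .inr (.inr i) => {z | Bits.val (lo i) ≤ Bits.val z.2 ∧ Bits.val z.2 < Bits.val (hi i)}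

/-- A sample that is representative on the test sets is representative on all hypotheses. -/
lemma representative_of_testSet (D : Measure (Bits c × Bits b)) [IsProbabilityMeasure D]
    (f : Bits c × Bits b → Bool) {lo hi : Fin 129 → Bits b}
    (hlohi : ∀ i, belowProb D (hi i) ≤ belowProb D (lo i) + 1 / 128)
    (hcover : ∀ t : Bits b, ∃ i, Bits.val (lo i) ≤ Bits.val t ∧ Bits.val t ≤ Bits.val (hi i))
    (S : Fin m → Bits c × Bits b)
    (hS : ∀ a, |countIn S (testSet f lo hi a) - m * D.real (testSet f lo hi a)| < m * (1 / 128))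
    (k : Bits c) (t : Bits b) :
    m * genError D f (concept k t) ≤ countIn S {z | concept k t z ≠ f z} + 4 / 128 * m ∧
    |countIn S {z | Bits.val z.2 < Bits.val t} - m * belowProb D t| ≤ 3 / 128 * m := by
  obtain ⟨i, hlo, hhi⟩ := hcover t
  have hm : (0 : ℝ) ≤ m := by positivity
  have hB : D.real (testSet f lo hi (.inr (.inr i))) ≤ 1 / 128 := by
    simp only [testSet]
    rw [measureReal_between D (hlo.trans hhi)]
    linarith [hlohi i]
  have hsub : {z : Bits c × Bits b | Bits.val (lo i) ≤ Bits.val z.2 ∧ Bits.val z.2 < Bits.val t} ⊆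
      testSet f lo hi (.inr (.inr i)) := fun z hz => ⟨hz.1, lt_of_lt_of_le hz.2 hhi⟩
  have h1 := abs_lt.1 (hS (.inl (k, i)))
  have h2 := abs_lt.1 (hS (.inr (.inl i)))
  have h3 := abs_lt.1 (hS (.inr (.inr i)))
  have hmB : m * D.real (testSet f lo hi (.inr (.inr i))) ≤ m * (1 / 128) := by gcongr
  have hF1 : belowProb D (lo i) ≤ belowProb D t :=
    measureReal_mono fun z hz => lt_of_lt_of_le hz hlo
  have hF2 : belowProb D t ≤ belowProb D (lo i) + 1 / 128 :=
    le_trans (measureReal_mono fun z hz => lt_of_lt_of_le hz hhi) (hlohi i)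
  have hmF1 := mul_le_mul_of_nonneg_left hF1 hm
  have hmF2 := mul_le_mul_of_nonneg_left hF2 hm
  have hD2 : D.real (testSet f lo hi (.inr (.inl i))) = belowProb D (lo i) := rfl
  rw [hD2] at h2
  constructor
  -- Passing to `lo i` and back costs the mass of the bracket, at most `1 / 128`, and its frequency,
  -- at most `2 / 128`; the sampling error at `lo i` adds `1 / 128`.
  · have h4 : D.real {z | concept k t z ≠ f z} ≤
        D.real (testSet f lo hi (.inl (k, i))) + D.real (testSet f lo hi (.inr (.inr i))) :=
      (measureReal_mono ((setOf_concept_ne_subset f k hlo).2.trans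
        (Set.union_subset_union_right _ hsub))).trans (measureReal_union_le _ _)
    have h5 : countIn S (testSet f lo hi (.inl (k, i))) ≤
        countIn S {z | concept k t z ≠ f z} + countIn S (testSet f lo hi (.inr (.inr i))) :=
      countIn_le_add S ((setOf_concept_ne_subset f k hlo).1.trans
        (Set.union_subset_union_right _ hsub))
    have h6 := mul_le_mul_of_nonneg_left h4 hm
    change m * D.real {z | concept k t z ≠ f z} ≤ _
    linarith
  · have h4 : countIn S (testSet f lo hi (.inr (.inl i))) ≤
        countIn S {z | Bits.val z.2 < Bits.val t} :=
      countIn_mono S fun z hz => lt_of_lt_of_le hz hlo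
    have h5 : countIn S {z | Bits.val z.2 < Bits.val t} ≤
        countIn S (testSet f lo hi (.inr (.inl i))) +
          countIn S (testSet f lo hi (.inr (.inr i))) := by
      refine countIn_le_add S fun z hz => ?_
      by_cases hz' : Bits.val z.2 < Bits.val (lo i)
      · exact Or.inl hz'
      · exact Or.inr ⟨not_lt.1 hz', lt_of_lt_of_le hz hhi⟩
    rw [abs_le]
    constructor <;> linarith

/-- The sample `S` labeled by `f`. -/
def labeled {X : Type} (f : X → Bool) (S : Fin m → X) : Fin m → X × Bool := fun j => (S j, f (S j))

lemma errCount_labeled (f : Bits c × Bits b → Bool) (S : Fin m → Bits c × Bits b) (k : Bits c)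
    (t : Bits b) : errCount (labeled f S) k t = countIn S {z | concept k t z ≠ f z} := by
  unfold errCount countIn
  refine Finset.sum_congr rfl fun j _ => ?_
  split_ifs with h1 h2 h2
  · rfl
  · exact absurd h1 h2
  · exact absurd h2 h1
  · rfl

lemma belowCount_labeled (f : Bits c × Bits b → Bool) (S : Fin m → Bits c × Bits b)
    (t : Bits b) :
    belowCount (labeled f S) t = countIn S {z | Bits.val z.2 < Bits.val t} := by
  unfold belowCount countIn
  refine Finset.sum_congr rfl fun j _ => ?_
  split_ifs with h1 h2 h2
  · rfl
  · exact absurd h1 h2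
  · exact absurd h2 h1
  · rfl

/-- The correct parity and its approximate quantile have a small loss. -/
lemma exists_curatorLoss_le (hm : 0 < m) (k : Bits c) (t : Bits b)
    (S : Fin m → Bits c × Bits b) :
    ∃ o, curatorLoss (labeled (concept k t) S) o ≤ m / 128 := by
  have hm' : (0 : ℝ) < m := by exact_mod_cast hm
  set B := belowCount (labeled (concept k t) S) t with hB
  have hB0 : 0 ≤ B := Finset.sum_nonneg fun j _ => by split_ifs <;> norm_num
  have hBm : B ≤ m := by
    calc B ≤ ∑ _j : Fin m, (1 : ℝ) := Finset.sum_le_sum fun j _ => by split_ifs <;> norm_num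
      _ = m := by simp
  -- The empirical quantile is rounded down to a multiple of `1 / 128`; the index `128` occurs when
  -- all examples are below `t`.
  have h1 := Nat.floor_le (div_nonneg (mul_nonneg (by norm_num : (0 : ℝ) ≤ 128) hB0) hm'.le)
  have h2 := Nat.lt_floor_add_one (128 * B / m)
  have hlt : ⌊128 * B / m⌋₊ < 129 := by
    rw [Nat.lt_succ_iff]
    refine Nat.floor_le_of_le ?_
    rw [div_le_iff₀ hm']
    push_cast
    linarith
  refine ⟨(k, ⟨_, hlt⟩), (Finset.inf'_le _ (Finset.mem_univ t)).trans ?_⟩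
  have herr : errCount (labeled (concept k t) S) k t = 0 := by
    rw [errCount_labeled]
    simp [countIn]
  rw [le_div_iff₀ hm'] at h1
  rw [div_lt_iff₀ hm'] at h2
  simp only [herr, zero_add]
  rw [← hB, abs_le]
  constructor <;> linarith

/-- If the sample of the curator is representative, the curator selects well and the estimates of
the agents are accurate, then the hypothesis is good. -/
lemma genError_hypothesis_le (D : Measure (Bits c × Bits b)) [IsProbabilityMeasure D]
    (f : Bits c × Bits b → Bool) (S : Fin m → Bits c × Bits b) (o : Bits c × Fin 129)
    (msgs : Fin n → AgentMsg b) (hm : 0 < m) (hn : 0 < n)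
    (hS : ∀ k t,
      m * genError D f (concept k t) ≤ countIn S {z | concept k t z ≠ f z} + 4 / 128 * m ∧
      |countIn S {z | Bits.val z.2 < Bits.val t} - m * belowProb D t| ≤ 3 / 128 * m)
    (ho : curatorLoss (labeled f S) o ≤ m / 128 + m / 128)
    (hest : ∀ t, |∑ i, belowEstimator t (msgs i) - n * belowProb D t| ≤ 2 / 128 * n) :
    genError D f (hypothesis o msgs) ≤ 1 / 4 := by
  have hm' : (0 : ℝ) < m := by exact_mod_cast hm
  have hn' : (0 : ℝ) < n := by exact_mod_cast hn
  -- The threshold that attains the loss of the selected pair; it need not be the true one.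
  obtain ⟨t, -, ht⟩ := Finset.exists_mem_eq_inf' (Finset.univ_nonempty (α := Bits b))
    fun t : Bits b => errCount (labeled f S) o.1 t +
      |belowCount (labeled f S) t - (o.2 : ℕ) / 128 * m|
  have ht' : curatorLoss (labeled f S) o = errCount (labeled f S) o.1 t +
      |belowCount (labeled f S) t - (o.2 : ℕ) / 128 * m| := ht
  rw [ht', errCount_labeled, belowCount_labeled] at ho
  obtain ⟨h1, h2⟩ := hS o.1 t
  set p : ℝ := ((o.2 : ℕ) : ℝ) / 128 with hp
  -- `2 / 128` is the loss, `4 / 128` and `3 / 128` are sampling errors.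
  have h3 : genError D f (concept o.1 t) + |belowProb D t - p| ≤ 9 / 128 := by
    have h4 : |m * belowProb D t - p * m| ≤
        |countIn S {z | Bits.val z.2 < Bits.val t} - m * belowProb D t| +
        |countIn S {z | Bits.val z.2 < Bits.val t} - p * m| := by
      rw [abs_sub_comm (countIn S _) (m * belowProb D t)]
      exact abs_sub_le _ _ _
    have h5 : |m * belowProb D t - p * m| = m * |belowProb D t - p| := by
      rw [mul_comm p, ← mul_sub, abs_mul, abs_of_pos hm']
    rw [h5] at h4
    refine le_of_mul_le_mul_left ?_ hm'
    rw [mul_add]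
    linarith
  have hest' : ∀ s, |(∑ i, belowEstimator s (msgs i)) / n - belowProb D s| ≤ 2 / 128 := by
    intro s
    have h4 : (∑ i, belowEstimator s (msgs i)) / n - belowProb D s =
        (∑ i, belowEstimator s (msgs i) - n * belowProb D s) / n := by
      field_simp
    rw [h4, abs_div, abs_of_pos hn', div_le_iff₀ hn']
    exact hest s
  have h4 := quantileThreshold_le (o.2 : ℕ) msgs t
  rw [← hp] at h4
  set s := quantileThreshold (o.2 : ℕ) msgs with hs
  have h5 := genError_concept_le D f o.1 s t
  have h6 := hest' s
  have h7 := hest' t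
  -- By its choice `s` is at least as close to `p` in the estimates as `t`. The total error is then
  -- at most `(2 * 9 + 4) / 128 ≤ 1 / 4`.
  have h8 : |belowProb D s - belowProb D t| ≤ 2 * |belowProb D t - p| + 4 / 128 := by
    have a1 := abs_sub_le (belowProb D s) ((∑ i, belowEstimator s (msgs i)) / n) (belowProb D t)
    have a2 := abs_sub_le ((∑ i, belowEstimator s (msgs i)) / n) p (belowProb D t)
    have a3 := abs_sub_le ((∑ i, belowEstimator t (msgs i)) / n) (belowProb D t) p
    rw [abs_sub_comm (belowProb D s) (_ / _)] at a1
    rw [abs_sub_comm p] at a2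
    linarith
  have h9 : 0 ≤ genError D f (concept o.1 t) := measureReal_nonneg
  change genError D f (concept o.1 s) ≤ 1 / 4
  linarith

lemma integral_pi_one_below (D : Measure (Bits c × Bits b)) [IsProbabilityMeasure D]
    (t : Bits b) :
    ∫ x, (if Bits.val (x 0).2 < Bits.val t then (1 : ℝ) else 0)
      ∂(Measure.pi fun _ : Fin 1 => D) = belowProb D t := by
  have h4 := (measurePreserving_eval (fun _ : Fin 1 => D) 0).measureReal_preimage
    (s := {z | Bits.val z.2 < Bits.val t}) (Set.toFinite _).measurableSet.nullMeasurableSet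
  have h5 : (fun x : Fin 1 → Bits c × Bits b =>
      if Bits.val (x 0).2 < Bits.val t then (1 : ℝ) else 0) = (Function.eval (0 : Fin 1) ⁻¹'
      {z : Bits c × Bits b | Bits.val z.2 < Bits.val t}).indicator fun _ => (1 : ℝ) := by
    funext x
    simp only [Set.indicator, Set.mem_preimage, Set.mem_ofPred_eq, Function.eval]
  rw [h5, integral_indicator_const _ (Set.toFinite _).measurableSet, smul_eq_mul, mul_one, h4]
  rfl

/-- The sample of the curator represents the distribution with high probability. -/
lemma measureReal_not_representative_le (D : Measure (Bits c × Bits b)) [IsProbabilityMeasure D]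
    {ι : Type*} [Fintype ι] (E : ι → Set (Bits c × Bits b)) :
    (Measure.pi fun _ : Fin m => D).real
        {S | ∃ a, m * (1 / 128 : ℝ) ≤ |countIn S (E a) - m * D.real (E a)|} ≤
      Fintype.card ι * (2 * Real.exp (-(m / 2 ^ 15))) := by
  classical
  have h1 : {S : Fin m → Bits c × Bits b |
      ∃ a, m * (1 / 128 : ℝ) ≤ |countIn S (E a) - m * D.real (E a)|} =
      ⋃ a, {S | m * (1 / 128 : ℝ) ≤ |countIn S (E a) - m * D.real (E a)|} := by
    ext S; simp
  rw [h1]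
  refine (measureReal_iUnion_fintype_le _).trans ?_
  calc _ ≤ ∑ _a : ι, 2 * Real.exp (-(m / 2 ^ 15)) := by
        refine Finset.sum_le_sum fun a _ => ?_
        have h2 := hoeffding_pi (fun _ : Fin m => D) Finset.univ
          (fun _ z => if z ∈ E a then 1 else 0) (fun _ => Measurable.of_discrete) (B := 1)
          (fun _ _ z => by split_ifs <;> norm_num) (δ := 1 / 128) (by norm_num)
        have h3 : ∫ z, (if z ∈ E a then (1 : ℝ) else 0) ∂D = D.real (E a) := by
          have : (fun z => if z ∈ E a then (1 : ℝ) else 0) = (E a).indicator fun _ => 1 := by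
            funext z; simp [Set.indicator_apply]
          rw [this, integral_indicator_const _ (Set.toFinite _).measurableSet]
          simp
        simp only [h3, Finset.sum_const, Finset.card_univ, Fintype.card_fin, nsmul_eq_mul] at h2
        refine le_trans (le_of_eq ?_) (h2.trans (le_of_eq ?_))
        · simp only [countIn]
        · congr 3
          ring
    _ = _ := by simp

/-- The data of the agents represent the distribution with high probability. -/
lemma measureReal_not_agents_representative_le (D : Measure (Bits c × Bits b))
    [IsProbabilityMeasure D] :
    (Measure.pi fun i : Option (Fin n) => Measure.pi fun _ : Fin (hybridSize m n i) => D).real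
        {x | ∃ t : Bits b, n * (1 / 128 : ℝ) ≤
          |∑ i, (if Bits.val (x (some i) (0 : Fin 1)).2 < Bits.val t then 1 else 0) -
            n * belowProb D t|} ≤
      2 ^ b * (2 * Real.exp (-(n / 2 ^ 15))) := by
  have h1 : {x : (i : Option (Fin n)) → Fin (hybridSize m n i) → Bits c × Bits b |
      ∃ t : Bits b, n * (1 / 128 : ℝ) ≤
          |∑ i, (if Bits.val (x (some i) (0 : Fin 1)).2 < Bits.val t then 1 else 0) -
            n * belowProb D t|} =
      ⋃ t : Bits b, {x | n * (1 / 128 : ℝ) ≤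
          |∑ i, (if Bits.val (x (some i) (0 : Fin 1)).2 < Bits.val t then 1 else 0) -
            n * belowProb D t|} := by
    ext S; simp
  rw [h1]
  refine (measureReal_iUnion_fintype_le _).trans ?_
  calc _ ≤ ∑ _t : Bits b, 2 * Real.exp (-(n / 2 ^ 15)) := by
        refine Finset.sum_le_sum fun t _ => ?_
        let f : (i : Option (Fin n)) → (Fin (hybridSize m n i) → Bits c × Bits b) → ℝ
          | none => fun _ => 0
          | some _ => fun x => if Bits.val (x (0 : Fin 1)).2 < Bits.val t then 1 else 0
        have h2 := hoeffding_pi_some (fun i : Option (Fin n) =>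
            Measure.pi fun _ : Fin (hybridSize m n i) => D)
          f (fun _ => Measurable.of_discrete) (B := 1)
          (fun i z => by simp only [f]; split_ifs <;> norm_num) (δ := 1 / 128) (by norm_num)
        have h3 : ∀ i : Fin n, ∫ x, f (some i) x
            ∂(Measure.pi fun _ : Fin (hybridSize m n (some i)) => D) = belowProb D t := by
          intro i
          exact integral_pi_one_below D t
        simp only [h3, Finset.sum_const, Finset.card_univ, Fintype.card_fin, nsmul_eq_mul] at h2
        refine h2.trans (le_of_eq ?_)
        congr 3
        ring
    _ = _ := by simp

end Referee

/-! ### The hybrid protocol and the errors of its messages -/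

section HybridLearner

variable (b c m n : ℕ) [NeZero b]

/-- The parties of the hybrid learner. -/
noncomputable def hybridParty :
    (i : Option (Fin n)) → Party (hybridSize m n i) ((Bits c × Bits b) × Bool)
  | none => (expMechanism curatorLoss : Mechanism (Fin m → (Bits c × Bits b) × Bool) _).toParty
  | some _ => (agentMechanism b c).toParty

/-- The hybrid learner: the curator selects a parity and a quantile, the agents send estimators of
the quantiles of all thresholds. -/
noncomputable def hybridLearner :
    HybridProtocol m n ((Bits c × Bits b) × Bool) (Bits c × Bits b → Bool) where
  rounds := 1
  party := hybridParty b c m n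
  RefCoins := Unit
  refLaw := Measure.dirac ()
  query _ _ _ := 0
  measurable_query _ _ := measurable_const
  output _ replies := match replies with
    | [] => fun _ => false
    | r :: _ => hypothesis (Function.invFun Mechanism.code (r none))
        fun i => Function.invFun Mechanism.code (r (some i))
  measurable_output _ := measurable_const

lemma hybridLearner_nonInteractive : (hybridLearner b c m n).NonInteractive :=
  ⟨rfl, fun _ _ => rfl⟩

lemma hybridLearner_isDP : (hybridLearner b c m n).IsDP (1 / 4) := by
  intro i A x x' hx T hT
  rw [add_zero]
  match i with
  | none => exact Mechanism.advProb_toParty_le _ (fun x x' hx o =>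
      expMechanism_weight_le (fun o => abs_curatorLoss_sub_le hx o) o) A hx hT
  | some _ => exact Mechanism.advProb_toParty_le _ (fun x x' _ o =>
      agentMechanism_weight_le x x' o) A hx hT

variable {b c m n}

/-- The selection of the curator. -/
def curatorReply (x : (i : Option (Fin n)) → Fin (hybridSize m n i) → (Bits c × Bits b) × Bool)
    (ω : (i : Option (Fin n)) → (hybridParty b c m n i).Coins) : Bits c × Fin 129 :=
  (ω none : (Fin m → (Bits c × Bits b) × Bool) → Bits c × Fin 129) (x none)

/-- The messages of the agents. -/
def agentReplies (x : (i : Option (Fin n)) → Fin (hybridSize m n i) → (Bits c × Bits b) × Bool)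
    (ω : (i : Option (Fin n)) → (hybridParty b c m n i).Coins) : Fin n → AgentMsg b := fun i =>
  (ω (some i) : (Fin 1 → (Bits c × Bits b) × Bool) → AgentMsg b) (x (some i))

lemma hybridLearner_outcome
    (x : (i : Option (Fin n)) → Fin (hybridSize m n i) → (Bits c × Bits b) × Bool)
    (ω : (i : Option (Fin n)) → (hybridParty b c m n i).Coins) (ρ : Unit) :
    (hybridLearner b c m n).outcome x ω ρ = hypothesis (curatorReply x ω) (agentReplies x ω) := by
  have h1 : Function.invFun Mechanism.code (Mechanism.code (curatorReply x ω)) =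
      curatorReply x ω := Function.leftInverse_invFun Mechanism.code_injective _
  have h2 : ∀ i, Function.invFun Mechanism.code (Mechanism.code (agentReplies x ω i)) =
      agentReplies x ω i := fun i => Function.leftInverse_invFun Mechanism.code_injective _
  have h3 : (hybridLearner b c m n).outcome x ω ρ =
      hypothesis (Function.invFun Mechanism.code (Mechanism.code (curatorReply x ω)))
        fun i => Function.invFun Mechanism.code (Mechanism.code (agentReplies x ω i)) := rfl
  rw [h3, h1]
  simp only [h2]

/-- The noise of the agents is small with high probability. -/
lemma measureReal_noise_le
    (x : (i : Option (Fin n)) → Fin (hybridSize m n i) → (Bits c × Bits b) × Bool) :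
    (Measure.pi fun i : Option (Fin n) => (hybridParty b c m n i).law).real
        {ω | ∃ t : Bits b, n * (1 / 128 : ℝ) ≤
          |∑ i, belowEstimator t (agentReplies x ω i) -
            ∑ i, (if Bits.val (x (some i) (0 : Fin 1)).1.2 < Bits.val t then 1 else 0)|} ≤
      2 ^ b * (2 * Real.exp (-(n / (2 ^ 14 * (200 * b ^ 2))))) := by
  have h1 : {ω : (i : Option (Fin n)) → (hybridParty b c m n i).Coins |
      ∃ t : Bits b, n * (1 / 128 : ℝ) ≤
          |∑ i, belowEstimator t (agentReplies x ω i) -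
            ∑ i, (if Bits.val (x (some i) (0 : Fin 1)).1.2 < Bits.val t then 1 else 0)|} =
      ⋃ t : Bits b, {ω | n * (1 / 128 : ℝ) ≤
          |∑ i, belowEstimator t (agentReplies x ω i) -
            ∑ i, (if Bits.val (x (some i) (0 : Fin 1)).1.2 < Bits.val t then 1 else 0)|} := by
    ext S; simp
  rw [h1]
  refine (measureReal_iUnion_fintype_le _).trans ?_
  calc _ ≤ ∑ _t : Bits b, 2 * Real.exp (-(n / (2 ^ 14 * (200 * b ^ 2)))) := by
        refine Finset.sum_le_sum fun t _ => ?_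
        let f (i : Option (Fin n)) (ω : (hybridParty b c m n i).Coins) : ℝ :=
          match i, ω with
          | none, _ => 0
          | some i, ω => belowEstimator t
              ((ω : (Fin 1 → (Bits c × Bits b) × Bool) → AgentMsg b) (x (some i)))
        have hf : ∀ i, Measurable (f i) := by
          rintro (_ | i)
          · exact measurable_const
          · exact (Measurable.of_discrete (f := belowEstimator t)).comp
              ((agentMechanism b c).measurePreserving_toParty (x (some i))).measurable
        have h2 := hoeffding_pi_some (fun i : Option (Fin n) => (hybridParty b c m n i).law)
          f hf (B := 10 * b) (fun i z => belowEstimator_mem_Icc t _) (δ := 1 / 128) (by norm_num)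
        have h3 : ∀ i : Fin n, ∫ ω, f (some i) ω ∂(hybridParty b c m n (some i)).law =
            if Bits.val (x (some i) (0 : Fin 1)).1.2 < Bits.val t then 1 else 0 := by
          intro i
          refine Eq.trans ?_ (integral_belowEstimator t (x (some i)))
          have hpres := (agentMechanism b c).measurePreserving_toParty (x (some i))
          rw [← hpres.map_eq, integral_map hpres.aemeasurable
            (Measurable.of_discrete).aestronglyMeasurable]
          rfl
        simp only [h3] at h2
        refine h2.trans (le_of_eq ?_)
        congr 3
        have hb : (b : ℝ) ≠ 0 := by exact_mod_cast NeZero.ne b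
        field_simp
        norm_num
        ring
    _ = _ := by simp

/-- The curator selects well with high probability. -/
lemma measureReal_selection_le (hm : 0 < m) (k : Bits c) (t : Bits b)
    (x : (i : Option (Fin n)) → Fin (hybridSize m n i) → Bits c × Bits b) :
    (Measure.pi fun i : Option (Fin n) => (hybridParty b c m n i).law).real
        {ω | (m / 128 + m / 128 : ℝ) < curatorLoss (labeled (concept k t) (x none))
          (curatorReply (fun i => labeled (concept k t) (x i)) ω)} ≤
      2 ^ c * (129 * Real.exp (-(m / 2 ^ 11))) := by
  obtain ⟨o₀, ho₀⟩ := exists_curatorLoss_le hm k t (x none)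
  have h1 := expMechanism_utility curatorLoss (labeled (concept k t) (x none)) o₀
    (s := (m / 128 : ℝ)) ho₀
  have h2 := ((expMechanism curatorLoss : Mechanism (Fin m → (Bits c × Bits b) × Bool)
    _).measurePreserving_toParty (labeled (concept k t) (x none))).comp
    (measurePreserving_eval (fun i : Option (Fin n) => (hybridParty b c m n i).law) none)
  refine le_trans (le_of_eq ?_) (h1.trans (le_of_eq ?_))
  · exact h2.measureReal_preimage (s := {o | (m / 128 + m / 128 : ℝ) <
      curatorLoss (labeled (concept k t) (x none)) o})
      (Set.toFinite _).measurableSet.nullMeasurableSet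
  simp only [Fintype.card_prod, Fintype.card_pi, Fintype.card_bool, Finset.prod_const,
    Finset.card_univ, Fintype.card_fin]
  push_cast
  rw [mul_assoc]
  congr 3
  ring

end HybridLearner

/-! ### Accuracy of the hybrid protocol -/

section HybridAccuracy

/-- The common form of the four failure bounds. Since `exp (-1) ≤ 1 / 2`, the product is at most `2
^ (10 - 31)`. -/
lemma two_pow_mul_exp_le {K E : ℝ} {q : ℕ} (hq : 1 ≤ q) (hK : K ≤ 2 ^ 10)
    (hE : 32 * q ≤ E) : 2 ^ q * (K * Real.exp (-E)) ≤ 1 / 16 := by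
  have h1 : Real.exp (-E) ≤ (1 / 2) ^ (32 * q) := by
    calc Real.exp (-E) ≤ Real.exp (((32 * q : ℕ) : ℝ) * (-1)) :=
          Real.exp_le_exp.2 (by push_cast; linarith)
      _ = Real.exp (-1) ^ (32 * q) := Real.exp_nat_mul _ _
      _ ≤ (1 / 2) ^ (32 * q) := by
          refine pow_le_pow_left₀ (Real.exp_pos _).le ?_ _
          rw [Real.exp_neg, one_div]
          refine inv_anti₀ (by norm_num) ?_
          have := Real.add_one_le_exp (1 : ℝ)
          linarith
  have h2 : (2 : ℝ) ^ q * (1 / 2) ^ (32 * q) ≤ (1 / 2) ^ 31 := by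
    have h3 : (2 : ℝ) ^ q * (1 / 2) ^ (32 * q) = (1 / 2) ^ (31 * q) := by
      rw [show 32 * q = q + 31 * q by ring, pow_add, ← mul_assoc, ← mul_pow]
      norm_num
    rw [h3]
    exact pow_le_pow_of_le_one (by norm_num) (by norm_num) (by omega)
  calc 2 ^ q * (K * Real.exp (-E)) ≤ 2 ^ q * (2 ^ 10 * (1 / 2) ^ (32 * q)) := by gcongr
    _ = 2 ^ 10 * (2 ^ q * (1 / 2) ^ (32 * q)) := by ring
    _ ≤ 2 ^ 10 * (1 / 2) ^ 31 := by gcongr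
    _ ≤ 1 / 16 := by norm_num

variable {b c m n : ℕ} [NeZero b]

/-- The hybrid learner is accurate. -/
theorem hybridLearner_isPACLearner (hc : 1 ≤ c) (hm : 2 ^ 20 * c ≤ m) (hn : 2 ^ 30 * b ^ 3 ≤ n) :
    (hybridLearner b c m n).IsPACLearner (ParityThresh b c) (1 / 4) (1 / 4) := by
  rintro f ⟨k, t, rfl⟩ D hD
  change _ ≤ Measure.real _ {s | genError D (concept k t) _ ≤ 1 / 4}
  have hb : 1 ≤ b := Nat.one_le_iff_ne_zero.2 (NeZero.ne b)
  have hm0 : 0 < m := by omega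
  have hn0 : 0 < n := lt_of_lt_of_le (by positivity) hn
  have hm' : (2 ^ 20 * c : ℝ) ≤ m := by exact_mod_cast hm
  have hn' : (2 ^ 30 * b ^ 3 : ℝ) ≤ n := by exact_mod_cast hn
  have hb' : (1 : ℝ) ≤ b := by exact_mod_cast hb
  have hnb : (2 ^ 30 * b : ℝ) ≤ n := by
    refine le_trans ?_ hn'
    have : (b : ℝ) ≤ b ^ 3 := le_self_pow₀ hb' (by norm_num)
    gcongr
  -- The brackets depend on `D` only and are fixed before sampling. The union bound then runs over
  -- order `2 ^ c` test sets instead of `2 ^ (b + c)` hypotheses, which keeps `m` linear in `c`.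
  obtain ⟨lo, hi, hlohi, hcover⟩ := exists_brackets Bits.val (belowProb D)
    (fun t => measureReal_nonneg) (fun t => measureReal_le_one) 128 (by norm_num)
  let data := Measure.pi fun i : Option (Fin n) =>
    Measure.pi fun _ : Fin (hybridSize m n i) => D
  let law := Measure.pi fun i : Option (Fin n) => (hybridParty b c m n i).law
  let ref : Measure Unit := Measure.dirac ()
  let Ω := ((i : Option (Fin n)) → Fin (hybridSize m n i) → Bits c × Bits b) ×
    ((i : Option (Fin n)) → (hybridParty b c m n i).Coins) × Unit
  let lab (x : (i : Option (Fin n)) → Fin (hybridSize m n i) → Bits c × Bits b)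
      (i : Option (Fin n)) := labeled (concept k t) (x i)
  -- Four failures, each of probability at most `1 / 16`: unrepresentative data of the curator,
  -- unrepresentative data of the agents, poor selection, large noise.
  let E₁ : Set Ω := {s | ∃ a, m * (1 / 128 : ℝ) ≤
    |countIn (s.1 none) (testSet (concept k t) lo hi a) -
      m * D.real (testSet (concept k t) lo hi a)|}
  let E₂ : Set Ω := {s | ∃ t' : Bits b, n * (1 / 128 : ℝ) ≤
    |∑ i, (if Bits.val (s.1 (some i) (0 : Fin 1)).2 < Bits.val t' then 1 else 0) -
      n * belowProb D t'|}
  let E₃ : Set Ω := {s | (m / 128 + m / 128 : ℝ) <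
    curatorLoss (labeled (concept k t) (s.1 none)) (curatorReply (lab s.1) s.2.1)}
  let E₄ : Set Ω := {s | ∃ t' : Bits b, n * (1 / 128 : ℝ) ≤
    |∑ i, belowEstimator t' (agentReplies (lab s.1) s.2.1 i) -
      ∑ i, (if Bits.val (lab s.1 (some i) (0 : Fin 1)).1.2 < Bits.val t' then 1 else 0)|}
  have h₁ : (data.prod (law.prod ref)).real E₁ ≤ 1 / 16 := by
    have hpres := (measurePreserving_eval (fun i : Option (Fin n) =>
      Measure.pi fun _ : Fin (hybridSize m n i) => D) none).comp
      (measurePreserving_fst (μ := data) (ν := law.prod ref))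
    have h := measureReal_not_representative_le (m := m) D (testSet (concept k t) lo hi)
    refine (le_of_eq (hpres.measureReal_preimage (s := {S | ∃ a, m * (1 / 128 : ℝ) ≤
      |countIn S (testSet (concept k t) lo hi a) - m * D.real (testSet (concept k t) lo hi a)|})
      (Set.toFinite _).measurableSet.nullMeasurableSet)).trans (h.trans ?_)
    -- There are `129 * 2 ^ c + 258 ≤ 258 * 2 ^ c` test sets, each with a two-sided tail; hence
    -- `516`.
    refine le_trans ?_ (two_pow_mul_exp_le hc (K := 516) (E := m / 2 ^ 15) (by norm_num)
      (by rw [le_div_iff₀ (by positivity)]; linarith))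
    simp only [Fintype.card_sum, Fintype.card_prod, Fintype.card_pi, Fintype.card_bool,
      Finset.prod_const, Finset.card_univ, Fintype.card_fin]
    push_cast
    have h2 : (2 : ℝ) ≤ 2 ^ c := le_self_pow₀ (by norm_num) (by omega)
    rw [← mul_assoc, ← mul_assoc]
    refine mul_le_mul_of_nonneg_right ?_ (Real.exp_pos _).le
    linarith
  have h₂ : (data.prod (law.prod ref)).real E₂ ≤ 1 / 16 := by
    have h := measureReal_not_agents_representative_le (m := m) (n := n) D
    refine (le_of_eq ((measurePreserving_fst (μ := data) (ν := law.prod ref)).measureReal_preimage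
      (s := {x | ∃ t' : Bits b, n * (1 / 128 : ℝ) ≤
        |∑ i, (if Bits.val (x (some i) (0 : Fin 1)).2 < Bits.val t' then 1 else 0) -
          n * belowProb D t'|}) (Set.toFinite _).measurableSet.nullMeasurableSet)).trans
      (h.trans ?_)
    exact two_pow_mul_exp_le hb (by norm_num) (by rw [le_div_iff₀ (by positivity)]; linarith)
  have hmeas : ∀ R : ((i : Option (Fin n)) → Fin (hybridSize m n i) → Bits c × Bits b) →
      Bits c × Fin 129 → (Fin n → AgentMsg b) → Prop,
      MeasurableSet {s : Ω | R s.1 (curatorReply (lab s.1) s.2.1)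
        (agentReplies (lab s.1) s.2.1)} := by
    intro R
    refine measurableSet_setOfPred.2 (Measurable.eval_countable
      (g := fun (s : Ω) x => R x (curatorReply (lab x) s.2.1) (agentReplies (lab x) s.2.1))
      (fun x => ?_) measurable_fst)
    have hcur : Measurable fun s : Ω => curatorReply (lab x) s.2.1 :=
      ((expMechanism curatorLoss).measurePreserving_toParty (lab x none)).measurable.comp
        ((measurable_pi_apply none).comp (measurable_fst.comp measurable_snd))
    have hag : Measurable fun s : Ω => agentReplies (lab x) s.2.1 :=
      measurable_pi_lambda _ fun i =>
        ((agentMechanism b c).measurePreserving_toParty (lab x (some i))).measurable.comp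
          ((measurable_pi_apply (some i)).comp (measurable_fst.comp measurable_snd))
    exact (Measurable.of_discrete (f := fun p : (Bits c × Fin 129) × (Fin n → AgentMsg b) =>
      R x p.1 p.2)).comp (hcur.prodMk hag)
  have hslice : ∀ (Q : ((i : Option (Fin n)) → (hybridParty b c m n i).Coins) → Prop),
      (law.prod ref).real {s | Q s.1} = law.real {ω | Q ω} := by
    intro Q
    have : {s : ((i : Option (Fin n)) → (hybridParty b c m n i).Coins) × Unit | Q s.1} =
        {ω | Q ω} ×ˢ Set.univ := by
      ext s; simp
    rw [this, measureReal_prod_prod]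
    simp
  have h₃ : (data.prod (law.prod ref)).real E₃ ≤ 1 / 16 := by
    refine measureReal_prod_le_of_forall _ _ (hmeas fun x o _ => (m / 128 + m / 128 : ℝ) <
      curatorLoss (labeled (concept k t) (x none)) o) fun x => ?_
    refine (le_of_eq (hslice _)).trans ((measureReal_selection_le hm0 k t x).trans ?_)
    exact two_pow_mul_exp_le hc (by norm_num) (by rw [le_div_iff₀ (by positivity)]; linarith)
  have h₄ : (data.prod (law.prod ref)).real E₄ ≤ 1 / 16 := by
    refine measureReal_prod_le_of_forall _ _ (hmeas fun x _ msgs => ∃ t' : Bits b,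
      n * (1 / 128 : ℝ) ≤ |∑ i, belowEstimator t' (msgs i) -
        ∑ i, (if Bits.val (lab x (some i) (0 : Fin 1)).1.2 < Bits.val t' then 1 else 0)|)
      fun x => ?_
    refine (le_of_eq (hslice _)).trans ((measureReal_noise_le (lab x)).trans ?_)
    refine two_pow_mul_exp_le hb (by norm_num) ?_
    rw [le_div_iff₀ (by positivity)]
    refine le_trans ?_ hn'
    have : (0 : ℝ) ≤ b ^ 3 := by positivity
    nlinarith
  -- Subadditivity on this cover bounds the success probability without measurability of the success
  -- event.
  have hgood : (Set.univ : Set Ω) ⊆ {s | genError D (concept k t)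
      ((hybridLearner b c m n).outcome (fun i j => (s.1 i j, concept k t (s.1 i j))) s.2.1 s.2.2) ≤
        1 / 4} ∪ (E₁ ∪ E₂ ∪ (E₃ ∪ E₄)) := by
    intro s _
    by_cases hs : s ∈ E₁ ∪ E₂ ∪ (E₃ ∪ E₄)
    · exact Or.inr hs
    · refine Or.inl ?_
      simp only [Set.mem_union, not_or] at hs
      obtain ⟨⟨hs1, hs2⟩, hs3, hs4⟩ := hs
      simp only [E₁, Set.mem_ofPred_eq, not_exists, not_le] at hs1
      simp only [E₂, Set.mem_ofPred_eq, not_exists, not_le] at hs2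
      simp only [E₃, Set.mem_ofPred_eq, not_lt] at hs3
      simp only [E₄, Set.mem_ofPred_eq, not_exists, not_le] at hs4
      have hout : (hybridLearner b c m n).outcome
          (fun i j => (s.1 i j, concept k t (s.1 i j))) s.2.1 s.2.2 =
          hypothesis (curatorReply (lab s.1) s.2.1) (agentReplies (lab s.1) s.2.1) :=
        hybridLearner_outcome _ _ _
      rw [Set.mem_ofPred_eq, hout]
      refine genError_hypothesis_le D (concept k t) (s.1 none) _ _ hm0 hn0
        (representative_of_testSet D (concept k t) (by simpa using hlohi) hcover (s.1 none) hs1)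
        hs3 fun t' => ?_
      have h1 := hs2 t'
      have h2 := hs4 t'
      refine (abs_sub_le _ (∑ i, (if Bits.val (s.1 (some i) (0 : Fin 1)).2 < Bits.val t'
        then (1 : ℝ) else 0)) _).trans ?_
      refine (add_le_add h2.le h1.le).trans (le_of_eq ?_)
      ring
  have htotal := (measureReal_mono (μ := data.prod (law.prod ref)) hgood).trans
    ((measureReal_union_le _ _).trans (add_le_add le_rfl ((measureReal_union_le _ _).trans
      (add_le_add (measureReal_union_le _ _) (measureReal_union_le _ _)))))
  rw [probReal_univ] at htotal
  refine le_trans ?_ (sub_le_iff_le_add.2 htotal)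
  linarith

end HybridAccuracy

/-! ## The sizes of the hybrid model -/

/-- The number of samples of the curator. -/
def curatorSize (c : ℕ) : ℕ := 2 ^ 20 * c

/-- The number of agents. The first summand suffices for the learner. The constant of the second
one, which dominates, has to be small: a local protocol with `2 ^ O(c)` agents can learn. -/
noncomputable def agentCount (c : ℕ) : ℕ := 2 ^ 30 * c ^ 6 + ⌊(c : ℝ) ^ 6 * Real.logb 2 c / 2 ^ 12⌋₊

lemma isTheta_curatorSize :
    (fun c => (curatorSize c : ℝ)) =Θ[atTop] fun c : ℕ => (c : ℝ) := by
  simp only [curatorSize, Nat.cast_mul]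
  exact (isTheta_refl _ _).const_mul_left (by norm_num)

lemma le_agentCount {c : ℕ} (hc : 1 ≤ c) :
    (c : ℝ) ^ 6 * Real.logb 2 c / 2 ^ 12 ≤ agentCount c := by
  have h1 := (Nat.lt_floor_add_one ((c : ℝ) ^ 6 * Real.logb 2 c / 2 ^ 12)).le
  have h2 : (1 : ℝ) ≤ (c : ℝ) ^ 6 := one_le_pow₀ (by exact_mod_cast hc)
  unfold agentCount
  push_cast
  linarith

lemma eventually_agentCount_le :
    ∀ᶠ c : ℕ in atTop, (agentCount c : ℝ) ≤ (c : ℝ) ^ 6 * Real.logb 2 c / 2 ^ 11 := by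
  have hlog : Tendsto (fun c : ℕ => Real.logb 2 c) atTop atTop :=
    (Real.tendsto_logb_atTop (by norm_num)).comp tendsto_natCast_atTop_atTop
  -- From `2 ^ 42` on, `2 ^ 30 * c ^ 6` is at most the second summand before rounding.
  filter_upwards [hlog.eventually_ge_atTop (2 ^ 42)] with c hc
  have h0 : (0 : ℝ) ≤ (c : ℝ) ^ 6 := by positivity
  have h1 := Nat.floor_le (div_nonneg (mul_nonneg h0
    (le_trans (by norm_num) hc : (0 : ℝ) ≤ Real.logb 2 c)) (by norm_num : (0 : ℝ) ≤ 2 ^ 12))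
  have h2 := mul_le_mul_of_nonneg_left hc h0
  unfold agentCount
  push_cast
  linarith

lemma isTheta_agentCount :
    (fun c => (agentCount c : ℝ)) =Θ[atTop] fun c : ℕ => (c : ℝ) ^ 6 * Real.logb 2 c := by
  constructor
  · refine IsBigO.of_bound 1 ?_
    filter_upwards [eventually_agentCount_le, eventually_ge_atTop 1] with c hc hc1
    have h0 : (0 : ℝ) ≤ (c : ℝ) ^ 6 * Real.logb 2 c := mul_nonneg (by positivity)
      (Real.logb_nonneg (by norm_num) (by exact_mod_cast hc1))
    rw [Real.norm_of_nonneg (by positivity), Real.norm_of_nonneg h0]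
    linarith
  · refine IsBigO.of_bound (2 ^ 12) ?_
    filter_upwards [eventually_ge_atTop 1] with c hc1
    have h0 : (0 : ℝ) ≤ (c : ℝ) ^ 6 * Real.logb 2 c := mul_nonneg (by positivity)
      (Real.logb_nonneg (by norm_num) (by exact_mod_cast hc1))
    rw [Real.norm_of_nonneg h0, Real.norm_of_nonneg (by positivity)]
    have := le_agentCount hc1
    linarith

lemma eventually_localExponent_le :
    ∀ᶠ c : ℕ in atTop, localExponent (agentCount c) ≤ (c : ℝ) / 4 := by
  filter_upwards [eventually_agentCount_le, eventually_ge_atTop 2] with c hc hc2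
  have hc2' : (2 : ℝ) ≤ c := by exact_mod_cast hc2
  have hL : 0 < Real.logb 2 c := Real.logb_pos (by norm_num) (by linarith)
  have hn : (c : ℝ) ^ 6 ≤ agentCount c := by
    have h1 : c ^ 6 ≤ agentCount c := by unfold agentCount; omega
    exact_mod_cast h1
  have hlog : 6 * Real.logb 2 c ≤ Real.logb 2 (agentCount c) := by
    have h1 : 6 * Real.logb 2 c = Real.logb 2 ((c : ℝ) ^ 6) := by
      rw [Real.logb_pow]; norm_num
    rw [h1]
    exact Real.logb_le_logb_of_le (by norm_num) (by positivity) hn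
  -- Since `log n ≥ 6 * log c`, the ratio is at most `c ^ 6 / (6 * 2 ^ 11)`, which is below `c ^ 6 /
  -- 4 ^ 6`.
  have hratio : (agentCount c : ℝ) / Real.logb 2 (agentCount c) ≤ ((c : ℝ) / 4) ^ 6 := by
    rw [div_le_iff₀ (by linarith)]
    calc (agentCount c : ℝ) ≤ (c : ℝ) ^ 6 * Real.logb 2 c / 2 ^ 11 := hc
      _ ≤ ((c : ℝ) / 4) ^ 6 * (6 * Real.logb 2 c) := by
        have : 0 ≤ (c : ℝ) ^ 6 * Real.logb 2 c := by positivity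
        rw [div_pow]
        linarith
      _ ≤ _ := by gcongr
  unfold localExponent
  calc _ ≤ (((c : ℝ) / 4) ^ 6) ^ (1 / 6 : ℝ) := by
        refine Real.rpow_le_rpow ?_ hratio (by norm_num)
        exact div_nonneg (by positivity) (by linarith)
    _ = (c : ℝ) / 4 := by
        rw [← Real.rpow_natCast, ← Real.rpow_mul (by positivity)]
        norm_num

/-- A private local protocol with at most `2 ^ (c / 4)` agents cannot learn. -/
lemma two_pow_lt_of_local_learner {b c N : ℕ} (hc : 8 ≤ c)
    (P : LocalProtocol N ((Bits c × Bits b) × Bool) (Bits c × Bits b → Bool))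
    (hP : P.IsPrivateLearner) : (2 : ℝ) ^ ((c : ℝ) / 4) < N := by
  by_contra! hN
  have h := local_lower_bound P hP
  have hc' : (8 : ℝ) ≤ c := by exact_mod_cast hc
  -- The exponents add up to `3 * c / 4 ≤ c - 2`, and `3 / 4 * 2 ^ c ≤ 4 + 2 ^ c / 4` fails for `c ≥
  -- 8`.
  have h1 : (N : ℝ) * √(2 ^ c) ≤ 2 ^ ((c : ℝ) - 2) := by
    calc (N : ℝ) * √(2 ^ c) ≤ 2 ^ ((c : ℝ) / 4) * 2 ^ ((c : ℝ) / 2) := by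
          have h2 : √((2 : ℝ) ^ c) = 2 ^ ((c : ℝ) / 2) := by
            rw [Real.sqrt_eq_rpow, ← Real.rpow_natCast, ← Real.rpow_mul (by norm_num)]
            ring_nf
          rw [h2]
          gcongr
      _ = 2 ^ ((c : ℝ) / 4 + (c : ℝ) / 2) := (Real.rpow_add (by norm_num) _ _).symm
      _ ≤ 2 ^ ((c : ℝ) - 2) := Real.rpow_le_rpow_of_exponent_le (by norm_num) (by linarith)
  have h2 : (2 : ℝ) ^ ((c : ℝ) - 2) = 2 ^ c / 4 := by
    rw [Real.rpow_sub (by norm_num), Real.rpow_natCast]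
    norm_num
  have h3 : (2 : ℝ) ^ 8 ≤ 2 ^ c := pow_le_pow_right₀ (by norm_num) hc
  linarith

/-- A private learner in the curator model needs `c ^ 2 / 8` samples. -/
lemma sq_le_of_curator_learner {c M : ℕ} (hc : 2 ≤ c)
    (P : CuratorProtocol M ((Bits c × Bits (c ^ 2)) × Bool) (Bits c × Bits (c ^ 2) → Bool))
    (hP : P.IsPrivateLearner) : (c : ℝ) ^ 2 / 8 ≤ M := by
  by_contra! hM
  have : NeZero (c ^ 2) := ⟨by positivity⟩
  have h := curator_lower_bound P hP
  set b := c ^ 2 with hb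
  have hb4 : 4 ≤ b := by nlinarith
  have hbc : (b : ℝ) = (c : ℝ) ^ 2 := by rw [hb]; push_cast; rfl
  rw [← hbc] at hM
  -- If `M < b / 8`, dividing the packing bound by `2 ^ b` gives `3 / 4 ≤ r ^ b`, whereas `r ^ 4 < 3
  -- / 4` and `b ≥ 4`.
  let r : ℝ := Real.exp (1 / 32) * (3 / 4) * 2 ^ (1 / 4 : ℝ)
  have hr0 : 0 ≤ r := by positivity
  have hr4 : r ^ 4 < 3 / 4 := by
    have h1 : r ^ 4 = Real.exp (1 / 8) * (3 / 4) ^ 4 * 2 := by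
      simp only [r]
      rw [mul_pow, mul_pow, ← Real.exp_nat_mul, ← Real.rpow_natCast (2 ^ (1 / 4 : ℝ)),
        ← Real.rpow_mul (by norm_num)]
      norm_num
    have h2 : Real.exp (1 / 8) < 23 / 20 := by
      have h3 := Real.exp_one_lt_d9
      have h4 : Real.exp (1 / 8) ^ 8 = Real.exp 1 := by rw [← Real.exp_nat_mul]; norm_num
      by_contra! hcon
      have := pow_le_pow_left₀ (by norm_num) hcon 8
      rw [h4] at this
      norm_num at this
      linarith
    rw [h1]
    linarith
  have hr1 : r ≤ 1 := by
    by_contra! hcon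
    have := one_le_pow₀ hcon.le (n := 4)
    linarith
  have hrb : r ^ b ≤ r ^ 4 := pow_le_pow_of_le_one hr0 hr1 hb4
  have hrb' : r ^ b = Real.exp (b / 32) * (3 / 4) ^ b * 2 ^ ((b : ℝ) / 4) := by
    simp only [r]
    rw [mul_pow, mul_pow, ← Real.exp_nat_mul, ← Real.rpow_natCast (2 ^ (1 / 4 : ℝ)),
      ← Real.rpow_mul (by norm_num)]
    ring_nf
  have h5 : (3 / 4 : ℝ) * 2 ^ b ≤ r ^ b * 2 ^ b := by
    calc (3 / 4 : ℝ) * 2 ^ b ≤ Real.exp (M / 4) * ((3 / 2) ^ b * 2 ^ ((b : ℝ) / 4)) := h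
      _ ≤ Real.exp (b / 32) * ((3 / 2) ^ b * 2 ^ ((b : ℝ) / 4)) :=
          mul_le_mul_of_nonneg_right (Real.exp_le_exp.2 (by linarith)) (by positivity)
      _ = r ^ b * 2 ^ b := by
          rw [hrb', show (3 / 2 : ℝ) = 3 / 4 * 2 by norm_num, mul_pow]
          ring
  have h6 := le_of_mul_le_mul_right h5 (by positivity)
  linarith
theorem mainTheorem1 :
    ∃ m n : ℕ → ℕ,
      -- the sizes of the hybrid model
      ((fun c => (m c : ℝ)) =Θ[atTop] fun c : ℕ => (c : ℝ)) ∧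
      ((fun c => (n c : ℝ)) =Θ[atTop] fun c : ℕ => (c : ℝ) ^ 6 * Real.logb 2 c) ∧
      -- a non-interactive learner in the hybrid model
      (∀ c : ℕ, 1 ≤ c →
        ∃ P : HybridProtocol (m c) (n c) ((Bits c × Bits (c ^ 2)) × Bool)
            (Bits c × Bits (c ^ 2) → Bool),
          P.NonInteractive ∧ P.IsPrivateLearner) ∧
      -- the number of rounds in the local model
      (∃ κ : ℝ, 0 < κ ∧ ∀ N : ℕ → ℕ,
        ((fun c => (N c : ℝ)) =o[atTop] fun c => (2 : ℝ) ^ localExponent (n c)) →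
        ∀ᶠ c in atTop,
          ∀ P : LocalProtocol (N c) ((Bits c × Bits (c ^ 2)) × Bool)
              (Bits c × Bits (c ^ 2) → Bool),
            P.IsPrivateLearner → (2 : ℝ) ^ (κ * localExponent (n c)) ≤ P.rounds) ∧
      -- the number of samples in the curator model
      (∃ κ : ℝ, 0 < κ ∧ ∀ᶠ c in atTop, ∀ M : ℕ,
        ∀ P : CuratorProtocol M ((Bits c × Bits (c ^ 2)) × Bool)
            (Bits c × Bits (c ^ 2) → Bool),
          P.IsPrivateLearner → κ * (m c : ℝ) ^ 2 ≤ M) := by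
  refine ⟨curatorSize, agentCount, isTheta_curatorSize, isTheta_agentCount, fun c hc => ?_,
    ⟨1, one_pos, fun N hN => ?_⟩, ⟨1 / 2 ^ 43, by positivity, ?_⟩⟩
  · have : NeZero (c ^ 2) := ⟨by positivity⟩
    refine ⟨hybridLearner (c ^ 2) c (curatorSize c) (agentCount c),
      hybridLearner_nonInteractive _ _ _ _, hybridLearner_isDP _ _ _ _,
      hybridLearner_isPACLearner hc le_rfl ?_⟩
    rw [← pow_mul]
    exact Nat.le_add_right _ _
  -- Eventually `N c ≤ 2 ^ (c / 4)`, too few agents for any private learner, so the bound on the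
  -- rounds holds vacuously and `κ = 1` does.
  · filter_upwards [hN.bound one_pos, eventually_localExponent_le, eventually_ge_atTop 8]
      with c hNc hexp hc P hP
    rw [Real.norm_of_nonneg (by positivity), Real.norm_of_nonneg (by positivity), one_mul] at hNc
    have h1 := two_pow_lt_of_local_learner hc P hP
    have h2 : (2 : ℝ) ^ localExponent (agentCount c) ≤ 2 ^ ((c : ℝ) / 4) :=
      Real.rpow_le_rpow_of_exponent_le (by norm_num) hexp
    linarith
  -- The constant `1 / 2 ^ 43` turns `m ^ 2 = 2 ^ 40 * c ^ 2` into `c ^ 2 / 8`.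
  · filter_upwards [eventually_ge_atTop 2] with c hc M P hP
    have h1 := sq_le_of_curator_learner hc P hP
    have h2 : (1 / 2 ^ 43 : ℝ) * (curatorSize c : ℝ) ^ 2 = (c : ℝ) ^ 2 / 8 := by
      simp only [curatorSize]
      push_cast
      ring
    rw [h2]
    exact h1
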